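/- **The system PHOML.** Fix three disjoint infinite sets of variables: term variables $x,y$, proof variables $p,q$, path variables $e$. Expressions, taken up to $\alpha$-conversion, are $$\begin{array}{ll} \text{Types} & A,B ::= \Omega \mid A\to B\\ \text{Terms} & M,N,\varphi,\psi ::= x\mid \bot\mid \varphi\supset\psi\mid \lambda x{:}A.M\mid MN\\ \text{Proofs} & \delta,\epsilon ::= p\mid \lambda p{:}\varphi.\delta\mid \delta\epsilon\mid P^+\mid P^-\\ \text{Paths} & P,Q ::= e\mid \mathsf{ref}(M)\mid P\supset^*Q\mid \mathsf{univ}_{\varphi,\psi}(\delta,\epsilon)\mid \lambda\!\!\lambda\!\!\lambda e{:}x=_Ay.P\mid P_{MN}Q\\ \text{Contexts} & \Gamma ::= \langle\rangle\mid \Gamma,x{:}A\mid\Gamma,p{:}\varphi\mid\Gamma,e{:}M=_AN \end{array}$$ where $\lambda\!\!\lambda\!\!\lambda e{:}x=_Ay.P$ binds $e,x,y$ ($x\neq y$) in $P$. $E[\sigma]$ denotes simultaneous capture-avoiding substitution of terms, proofs and paths for term, proof and path variables. *Path substitution.* For a function $\tau$ from a finite set of term variables to paths and functions $\rho,\sigma$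 from the same set to terms, the path $M\{\tau:\rho=\sigma\}$ (written $M\{\tau\}$ here) is defined by: $x\{\tau\}=\tau(x)$ for $x$ in the domain; $y\{\tau\}=\mathsf{ref}(y)$ otherwise; $\bot\{\tau\}=\mathsf{ref}(\bot)$; $(\varphi\supset\psi)\{\tau\}=\varphi\{\tau\}\supset^*\psi\{\tau\}$; $(LN)\{\tau\}=L\{\tau\}_{N[\rho]\,N[\sigma]}N\{\tau\}$; $(\lambda y{:}A.L)\{\tau:\rho=\sigma\}=\lambda\!\!\lambda\!\!\lambda e{:}a=_Aa'.L\{\tau,y:=e:(\rho,y:=a)=(\sigma,y:=a')\}$ with $e,a,a'$ fresh. $M\{\}$ is the case of empty domain. *Reduction* $\to$ is the least relation with the following rules. Terms: $(\lambda x{:}A.M)N\to M[x:=N]$; if $M\to M'$ then $MN\to M'N$, $M\supset\psi\to M'\supset\psi$ and $\varphi\supset M\to\varphi\supset M'$. Proofs: $(\lambda p{:}\varphi.\delta)\epsilon\to\delta[p:=\epsilon]$; $\mathsf{ref}(\varphi)^{+}\to\lambda p{:}\varphi.p$ and $\mathsf{ref}(\varphi)^{-}\to\lambda p{:}\varphi.p$;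 $\mathsf{univ}_{\varphi,\psi}(\delta,\epsilon)^+\to\delta$; $\mathsf{univ}_{\varphi,\psi}(\delta,\epsilon)^-\to\epsilon$; if $\delta\to\delta'$ then $\delta\epsilon\to\delta'\epsilon$; if $P\to Q$ then $P^+\to Q^+$ and $P^-\to Q^-$. Paths: $(\lambda\!\!\lambda\!\!\lambda e{:}x=_Ay.P)_{MN}Q\to P[x:=M,y:=N,e:=Q]$; $\mathsf{ref}(\lambda x{:}A.M)_{NN'}P\to M\{x:=P:N=N'\}$; $\mathsf{ref}(\varphi)\supset^*\mathsf{ref}(\psi)\to\mathsf{ref}(\varphi\supset\psi)$; $$\mathsf{ref}(\varphi)\supset^*\mathsf{univ}_{\psi,\chi}(\delta,\epsilon)\to\mathsf{univ}_{\varphi\supset\psi,\varphi\supset\chi}(\lambda p{:}\varphi\supset\psi.\lambda q{:}\varphi.\delta(pq),\ \lambda p{:}\varphi\supset\chi.\lambda q{:}\varphi.\epsilon(pq));$$ $$\mathsf{univ}_{\varphi,\psi}(\delta,\epsilon)\supset^*\mathsf{ref}(\chi)\to\mathsf{univ}_{\varphi\supset\chi,\psi\supset\chi}(\lambda p{:}\varphi\supset\chi.\lambda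 q{:}\psi.p(\epsilon q),\ \lambda p{:}\psi\supset\chi.\lambda q{:}\varphi.p(\delta q));$$ $$\mathsf{univ}_{\varphi,\psi}(\delta,\epsilon)\supset^*\mathsf{univ}_{\varphi',\psi'}(\delta',\epsilon')\to\mathsf{univ}_{\varphi\supset\varphi',\psi\supset\psi'}(\lambda p{:}\varphi\supset\varphi'.\lambda q{:}\psi.\delta'(p(\epsilon q)),\ \lambda p{:}\psi\supset\psi'.\lambda q{:}\varphi.\epsilon'(p(\delta q)));$$ if $P\to P'$ then $P_{MN}Q\to P'_{MN}Q$, $P\supset^*Q\to P'\supset^*Q$ and $Q\supset^*P\to Q\supset^*P'$; if $M\to M'$ then $\mathsf{ref}(M)_{NN'}P\to\mathsf{ref}(M')_{NN'}P$. $\twoheadrightarrow$ is the reflexive transitive closure and $\simeq$ the equivalence closure of $\to$. *Rules of deduction*, for judgements $\Gamma\vdash\mathcal J$ with $\mathcal J$ one of $\mathrm{valid}$, $M:A$, $\delta:\varphi$, $P:M=_AN$ (variables added to a context are fresh for it). Contexts: $\langle\rangle\vdash\mathrm{valid}$; $\Gamma,x{:}A\vdash\mathrm{valid}$ if $\Gamma\vdash\mathrm{valid}$;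 $\Gamma,p{:}\varphi\vdash\mathrm{valid}$ if $\Gamma\vdash\varphi:\Omega$; $\Gamma,e{:}M=_AN\vdash\mathrm{valid}$ if $\Gamma\vdash M:A$ and $\Gamma\vdash N:A$; and if $\Gamma\vdash\mathrm{valid}$ then $\Gamma\vdash z:T$ for every entry $z:T$ of $\Gamma$. Terms: $\Gamma\vdash\bot:\Omega$ if $\Gamma\vdash\mathrm{valid}$; $\Gamma\vdash\varphi\supset\psi:\Omega$ if $\Gamma\vdash\varphi:\Omega$ and $\Gamma\vdash\psi:\Omega$; the simply typed rules for $MN$ and $\lambda x{:}A.M$. Proofs: from $\delta:\varphi\supset\psi$ and $\epsilon:\varphi$ infer $\delta\epsilon:\psi$; from $\Gamma,p{:}\varphi\vdash\delta:\psi$ infer $\Gamma\vdash\lambda p{:}\varphi.\delta:\varphi\supset\psi$; from $\delta:\varphi$, $\psi:\Omega$ and $\varphi\simeq\psi$ infer $\delta:\psi$; from $P:\varphi=_\Omega\psi$ infer $P^+:\varphi\supset\psi$ and $P^-:\psi\supset\varphi$. Paths: from $M:A$ infer $\mathsf{ref}(M):M=_AM$; from $P:\varphi=_\Omega\varphi'$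 and $Q:\psi=_\Omega\psi'$ infer $P\supset^*Q:\varphi\supset\psi=_\Omega\varphi'\supset\psi'$; from $\delta:\varphi\supset\psi$ and $\epsilon:\psi\supset\varphi$ infer $\mathsf{univ}_{\varphi,\psi}(\delta,\epsilon):\varphi=_\Omega\psi$; from $\Gamma,x{:}A,y{:}A,e{:}x=_Ay\vdash P:Mx=_BNy$, $\Gamma\vdash M:A\to B$ and $\Gamma\vdash N:A\to B$ infer $\Gamma\vdash\lambda\!\!\lambda\!\!\lambda e{:}x=_Ay.P:M=_{A\to B}N$; from $P:M=_{A\to B}M'$, $Q:N=_AN'$, $N:A$ and $N':A$ infer $P_{NN'}Q:MN=_BM'N'$; from $P:M=_AN$, $M':A$, $N':A$, $M\simeq M'$ and $N\simeq N'$ infer $P:M'=_AN'$. *Computability.* Neutral paths are given by $P_n::=e\mid P_n\supset^*Q\mid Q\supset^*P_n\mid(P_n)_{MN}Q$, neutral proofs by $\delta_n::=p\mid P_n^+\mid P_n^-\mid\delta_n\epsilon$, canonical propositions by $\theta::=\bot\mid\theta\supset\theta$. The relation $\models E:T$ ("$E$ is computable of type $T$") is defined on arbitrary (not necessarily typable)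 expressions by: - $\models\delta:\bot$ iff $\delta\twoheadrightarrow\nu$ for some neutral proof $\nu$; - for canonical $\theta,\theta'$, $\models\delta:\theta\supset\theta'$ iff $\models\delta\epsilon:\theta'$ for all $\epsilon$ with $\models\epsilon:\theta$; - $\models\delta:\varphi$ iff $\varphi\twoheadrightarrow\theta$ for some canonical proposition $\theta$ with $\models\delta:\theta$; - $\models P:\varphi=_\Omega\psi$ iff $\models P^+:\varphi\supset\psi$ and $\models P^-:\psi\supset\varphi$; - $\models P:M=_{A\to B}M'$ iff $\models P_{NN'}Q:MN=_BM'N'$ for all $Q,N,N'$ with $\models N:A$, $\models N':A$ and $\models Q:N=_AN'$; - $\models M:A$ iff $\models M\{\}:M=_AM$. A substitution $\sigma$ is computable on $\Gamma$, $\models\sigma:\Gamma$, if $\models\sigma(z):T[\sigma]$ for every entry $z:T$ of $\Gamma$. A path substitution $\tau$ is computable between $\rho$ and $\sigma$, $\models\tau:\rho=\sigma:\Gamma$, if $\models\tau(x):\rho(x)=_A\sigma(x)$ for every term variable entry $x:A$ of $\Gamma$. For $\mathcal J$ of the form $E:T$, $\models\mathcal J[\sigma]$ means $\models E[\sigma]:T[\sigma]$;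 for $\mathcal J=\mathrm{valid}$ it is vacuously true. **Theorem.** 1. If $\Gamma\vdash\mathcal J$ and $\models\sigma:\Gamma$, then $\models\mathcal J[\sigma]$. 2. If $\Gamma\vdash M:A$ and $\models\tau:\rho=\sigma:\Gamma$, then $\models M\{\tau:\rho=\sigma\}:M[\rho]=_AM[\sigma]$. -/

import Mathlib

/-!
The system PHOML (predicative higher-order minimal logic with extensional equality).

Expressions are taken up to renaming of bound variables, by means of de Bruijn indices.  There are
three disjoint infinite supplies of variables (term, proof and path variables), so there are three
independent index spaces, each of them a copy of the natural numbers.  A binder shifts only the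
index spaces of the variables that it binds.
-/

namespace PHOML

/-- The simple types over `Ω`. -/
inductive Ty : Type
  | omega : Ty
  | arrow : Ty → Ty → Ty

/-- Terms `x | ⊥ | φ ⊃ ψ | λ x : A. M | M N`. -/
inductive Tm : Type
  | var : ℕ → Tm
  | bot : Tm
  | imp : Tm → Tm → Tm
  | lam : Ty → Tm → Tm
  | app : Tm → Tm → Tm

/-- The two kinds of expressions that are defined simultaneously. -/
inductive Kind : Type
  | proof : Kind
  | path : Kind

/-- Proofs and paths, by simultaneous induction. -/
inductive Exp : Kind → Type
  /-- the proof variable `p` -/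
  | pvar : ℕ → Exp Kind.proof
  /-- the proof `λ p : φ. δ`, binding a proof variable in `δ` -/
  | plam : Tm → Exp Kind.proof → Exp Kind.proof
  /-- the proof `δ ε` -/
  | papp : Exp Kind.proof → Exp Kind.proof → Exp Kind.proof
  /-- the proof `P⁺` -/
  | plus : Exp Kind.path → Exp Kind.proof
  /-- the proof `P⁻` -/
  | minus : Exp Kind.path → Exp Kind.proof
  /-- the path variable `e` -/
  | evar : ℕ → Exp Kind.path
  /-- the path `ref M` -/
  | ref : Tm → Exp Kind.path
  /-- the path `P ⊃* Q` -/
  | impStar : Exp Kind.path → Exp Kind.path → Exp Kind.path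
  /-- the path `univ φ ψ δ ε` -/
  | univ : Tm → Tm → Exp Kind.proof → Exp Kind.proof → Exp Kind.path
  /-- the path `λλλ e : x =_A y. P`, binding in `P` the term variables `x` (index 1) and
  `y` (index 0) and the path variable `e` (index 0) -/
  | lll : Ty → Exp Kind.path → Exp Kind.path
  /-- `eapp P M N Q` is the path `P_{M N} Q` -/
  | eapp : Exp Kind.path → Tm → Tm → Exp Kind.path → Exp Kind.path

/-- Proofs. -/
abbrev Pf : Type := Exp Kind.proof

/-- Paths. -/
abbrev Pa : Type := Exp Kind.path

/-- The sequence `a, f 0, f 1, …`. -/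
def scons {α : Type} (a : α) (f : ℕ → α) : ℕ → α
  | 0 => a
  | n + 1 => f n

/-! ### Renaming and substitution -/

/-- A renaming of indices, extended under one binder of the same sort. -/
def upr (f : ℕ → ℕ) : ℕ → ℕ := scons 0 (fun n => f n + 1)

/-- Renaming of term variables in a term. -/
def Tm.ren : (ℕ → ℕ) → Tm → Tm
  | f, .var n => .var (f n)
  | _, .bot => .bot
  | f, .imp φ ψ => .imp (φ.ren f) (ψ.ren f)
  | f, .lam A M => .lam A (M.ren (upr f))
  | f, .app M N => .app (M.ren f) (N.ren f)

/-- Renaming of term variables (by `f`), proof variables (by `g`) and path variables (by `h`) in a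
proof or a path. -/
def Exp.ren : {k : Kind} → (ℕ → ℕ) → (ℕ → ℕ) → (ℕ → ℕ) → Exp k → Exp k
  | _, _, g, _, .pvar n => .pvar (g n)
  | _, f, g, h, .plam φ δ => .plam (φ.ren f) (δ.ren f (upr g) h)
  | _, f, g, h, .papp δ ε => .papp (δ.ren f g h) (ε.ren f g h)
  | _, f, g, h, .plus P => .plus (P.ren f g h)
  | _, f, g, h, .minus P => .minus (P.ren f g h)
  | _, _, _, h, .evar n => .evar (h n)
  | _, f, _, _, .ref M => .ref (M.ren f)
  | _, f, g, h, .impStar P Q => .impStar (P.ren f g h) (Q.ren f g h)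
  | _, f, g, h, .univ φ ψ δ ε => .univ (φ.ren f) (ψ.ren f) (δ.ren f g h) (ε.ren f g h)
  | _, f, g, h, .lll A P => .lll A (P.ren (upr (upr f)) g (upr h))
  | _, f, g, h, .eapp P M N Q => .eapp (P.ren f g h) (M.ren f) (N.ren f) (Q.ren f g h)

/-- A term substitution, extended under a term binder. -/
def ups (s : ℕ → Tm) : ℕ → Tm := scons (.var 0) (fun n => (s n).ren Nat.succ)

/-- Simultaneous substitution of terms for the term variables of a term. -/
def Tm.sub : (ℕ → Tm) → Tm → Tm
  | s, .var n => s n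
  | _, .bot => .bot
  | s, .imp φ ψ => .imp (φ.sub s) (ψ.sub s)
  | s, .lam A M => .lam A (M.sub (ups s))
  | s, .app M N => .app (M.sub s) (N.sub s)

/-- A substitution maps term variables to terms, proof variables to proofs, path variables to
paths. -/
structure Subst : Type where
  tm : ℕ → Tm
  pf : ℕ → Pf
  pa : ℕ → Pa

/-- A substitution, extended under the binder of `λ p : φ. δ`. -/
def Subst.upP (σ : Subst) : Subst where
  tm := σ.tm
  pf := scons (.pvar 0) (fun n => (σ.pf n).ren id Nat.succ id)
  pa := fun n => (σ.pa n).ren id Nat.succ id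

/-- A substitution, extended under the binder of `λλλ e : x =_A y. P`. -/
def Subst.upE (σ : Subst) : Subst where
  tm := ups (ups σ.tm)
  pf := fun n => (σ.pf n).ren (fun m => m + 2) id Nat.succ
  pa := scons (.evar 0) (fun n => (σ.pa n).ren (fun m => m + 2) id Nat.succ)

/-- Simultaneous substitution in a proof or a path. -/
def Exp.sub : {k : Kind} → Subst → Exp k → Exp k
  | _, σ, .pvar n => σ.pf n
  | _, σ, .plam φ δ => .plam (φ.sub σ.tm) (δ.sub σ.upP)
  | _, σ, .papp δ ε => .papp (δ.sub σ) (ε.sub σ)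
  | _, σ, .plus P => .plus (P.sub σ)
  | _, σ, .minus P => .minus (P.sub σ)
  | _, σ, .evar n => σ.pa n
  | _, σ, .ref M => .ref (M.sub σ.tm)
  | _, σ, .impStar P Q => .impStar (P.sub σ) (Q.sub σ)
  | _, σ, .univ φ ψ δ ε => .univ (φ.sub σ.tm) (ψ.sub σ.tm) (δ.sub σ) (ε.sub σ)
  | _, σ, .lll A P => .lll A (P.sub σ.upE)
  | _, σ, .eapp P M N Q => .eapp (P.sub σ) (M.sub σ.tm) (N.sub σ.tm) (Q.sub σ)

/-- `M [x := N]`, where `x` is the term variable of index 0. -/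
def Tm.inst (M N : Tm) : Tm := M.sub (scons N Tm.var)

/-- `δ [p := ε]`, where `p` is the proof variable of index 0. -/
def instP (δ ε : Pf) : Pf := δ.sub ⟨Tm.var, scons ε Exp.pvar, Exp.evar⟩

/-- `P [x := M, y := N, e := Q]`, where `x`, `y`, `e` are the variables bound by a `λλλ`. -/
def instE (P : Pa) (M N : Tm) (Q : Pa) : Pa :=
  P.sub ⟨scons N (scons M Tm.var), Exp.pvar, scons Q Exp.evar⟩

/-! ### Path substitution -/

/-- Path substitution: `M.psub τ ρ σ` is the path `M {τ : ρ = σ}`.  A path substitution with finite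
domain is represented by the total function that sends a variable `y` outside the domain to `ref y`
(and `ρ`, `σ` are extended by `ρ y = σ y = y`). In the clause for `λ y : A. L`, the bound variable is
sent to the path variable `e : a = a'` bound by the `λλλ`. -/
def Tm.psub : (ℕ → Pa) → (ℕ → Tm) → (ℕ → Tm) → Tm → Pa
  | τ, _, _, .var n => τ n
  | _, _, _, .bot => .ref .bot
  | τ, ρ, σ, .imp φ ψ => .impStar (φ.psub τ ρ σ) (ψ.psub τ ρ σ)
  | τ, ρ, σ, .lam A L => .lll A (L.psub
      (scons (.evar 0) (fun n => (τ n).ren (fun m => m + 2) id Nat.succ))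
      (scons (.var 1) (fun n => (ρ n).ren (fun m => m + 2)))
      (scons (.var 0) (fun n => (σ n).ren (fun m => m + 2))))
  | τ, ρ, σ, .app L N => .eapp (L.psub τ ρ σ) (N.sub ρ) (N.sub σ) (N.psub τ ρ σ)

/-- `M {}`, path substitution with empty domain. -/
def Tm.psubNil (M : Tm) : Pa := M.psub (fun n => .ref (.var n)) Tm.var Tm.var

/-- `M {x := P : N = N'}`, where `x` is the term variable of index 0. -/
def Tm.psubOne (M : Tm) (P : Pa) (N N' : Tm) : Pa :=
  M.psub (scons P (fun n => .ref (.var n))) (scons N Tm.var) (scons N' Tm.var)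

/-! ### Call-by-name reduction -/

/-- One-step reduction on terms. -/
inductive RedTm : Tm → Tm → Prop
  | beta (A : Ty) (M N : Tm) : RedTm (.app (.lam A M) N) (M.inst N)
  | app {M M' : Tm} (N : Tm) : RedTm M M' → RedTm (.app M N) (.app M' N)
  | impL {φ φ' : Tm} (ψ : Tm) : RedTm φ φ' → RedTm (.imp φ ψ) (.imp φ' ψ)
  | impR (φ : Tm) {ψ ψ' : Tm} : RedTm ψ ψ' → RedTm (.imp φ ψ) (.imp φ ψ')

/-- Weakening of a proof by two fresh proof variables. -/
def wkPP (δ : Pf) : Pf := δ.ren id (fun n => n + 2) id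

/-- One-step reduction on paths.  In the three rules that create a `univ`, the bound variables are
`p` (index 1) and `q` (index 0). -/
inductive RedPa : Pa → Pa → Prop
  | beta (A : Ty) (P : Pa) (M N : Tm) (Q : Pa) :
      RedPa (.eapp (.lll A P) M N Q) (instE P M N Q)
  | refLam (A : Ty) (M N N' : Tm) (P : Pa) :
      RedPa (.eapp (.ref (.lam A M)) N N' P) (M.psubOne P N N')
  | refRef (φ ψ : Tm) : RedPa (.impStar (.ref φ) (.ref ψ)) (.ref (.imp φ ψ))
  | refUniv (φ ψ χ : Tm) (δ ε : Pf) :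
      RedPa (.impStar (.ref φ) (.univ ψ χ δ ε))
        (.univ (.imp φ ψ) (.imp φ χ)
          (.plam (.imp φ ψ) (.plam φ (.papp (wkPP δ) (.papp (.pvar 1) (.pvar 0)))))
          (.plam (.imp φ χ) (.plam φ (.papp (wkPP ε) (.papp (.pvar 1) (.pvar 0))))))
  | univRef (φ ψ χ : Tm) (δ ε : Pf) :
      RedPa (.impStar (.univ φ ψ δ ε) (.ref χ))
        (.univ (.imp φ χ) (.imp ψ χ)
          (.plam (.imp φ χ) (.plam ψ (.papp (.pvar 1) (.papp (wkPP ε) (.pvar 0)))))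
          (.plam (.imp ψ χ) (.plam φ (.papp (.pvar 1) (.papp (wkPP δ) (.pvar 0))))))
  | univUniv (φ ψ φ' ψ' : Tm) (δ ε δ' ε' : Pf) :
      RedPa (.impStar (.univ φ ψ δ ε) (.univ φ' ψ' δ' ε'))
        (.univ (.imp φ φ') (.imp ψ ψ')
          (.plam (.imp φ φ') (.plam ψ
            (.papp (wkPP δ') (.papp (.pvar 1) (.papp (wkPP ε) (.pvar 0))))))
          (.plam (.imp ψ ψ') (.plam φ
            (.papp (wkPP ε') (.papp (.pvar 1) (.papp (wkPP δ) (.pvar 0)))))))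
  | app {P P' : Pa} (M N : Tm) (Q : Pa) :
      RedPa P P' → RedPa (.eapp P M N Q) (.eapp P' M N Q)
  | refApp {M M' : Tm} (N N' : Tm) (P : Pa) :
      RedTm M M' → RedPa (.eapp (.ref M) N N' P) (.eapp (.ref M') N N' P)
  | impL {P P' : Pa} (Q : Pa) : RedPa P P' → RedPa (.impStar P Q) (.impStar P' Q)
  | impR (P : Pa) {Q Q' : Pa} : RedPa Q Q' → RedPa (.impStar P Q) (.impStar P Q')

/-- One-step reduction on proofs. -/
inductive RedPf : Pf → Pf → Prop
  | beta (φ : Tm) (δ ε : Pf) : RedPf (.papp (.plam φ δ) ε) (instP δ ε)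
  | refPlus (φ : Tm) : RedPf (.plus (.ref φ)) (.plam φ (.pvar 0))
  | refMinus (φ : Tm) : RedPf (.minus (.ref φ)) (.plam φ (.pvar 0))
  | app {δ δ' : Pf} (ε : Pf) : RedPf δ δ' → RedPf (.papp δ ε) (.papp δ' ε)
  | univPlus (φ ψ : Tm) (δ ε : Pf) : RedPf (.plus (.univ φ ψ δ ε)) δ
  | univMinus (φ ψ : Tm) (δ ε : Pf) : RedPf (.minus (.univ φ ψ δ ε)) ε
  | plus {P Q : Pa} : RedPa P Q → RedPf (.plus P) (.plus Q)
  | minus {P Q : Pa} : RedPa P Q → RedPf (.minus P) (.minus Q)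

/-- Convertibility of terms: the reflexive symmetric transitive closure of reduction. -/
def Conv (M N : Tm) : Prop := Relation.EqvGen RedTm M N

/-! ### Rules of deduction -/

/-- Contexts: `⟨⟩`, `Γ, x : A`, `Γ, p : φ` and `Γ, e : M =_A N` (written `extE Γ M A N`). -/
inductive Ctx : Type
  | nil : Ctx
  | extT : Ctx → Ty → Ctx
  | extP : Ctx → Tm → Ctx
  | extE : Ctx → Tm → Ty → Tm → Ctx

/-- `x : A ∈ Γ`. -/
inductive MemT : Ctx → ℕ → Ty → Prop
  | here (Γ : Ctx) (A : Ty) : MemT (.extT Γ A) 0 A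
  | extT {Γ : Ctx} {n : ℕ} {A : Ty} (B : Ty) : MemT Γ n A → MemT (.extT Γ B) (n + 1) A
  | extP {Γ : Ctx} {n : ℕ} {A : Ty} (φ : Tm) : MemT Γ n A → MemT (.extP Γ φ) n A
  | extE {Γ : Ctx} {n : ℕ} {A : Ty} (M : Tm) (B : Ty) (N : Tm) :
      MemT Γ n A → MemT (.extE Γ M B N) n A

/-- `p : φ ∈ Γ`, where `φ` is weakened to the whole of `Γ`. -/
inductive MemP : Ctx → ℕ → Tm → Prop
  | here (Γ : Ctx) (φ : Tm) : MemP (.extP Γ φ) 0 φ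
  | extT {Γ : Ctx} {n : ℕ} {φ : Tm} (B : Ty) :
      MemP Γ n φ → MemP (.extT Γ B) n (φ.ren Nat.succ)
  | extP {Γ : Ctx} {n : ℕ} {φ : Tm} (ψ : Tm) : MemP Γ n φ → MemP (.extP Γ ψ) (n + 1) φ
  | extE {Γ : Ctx} {n : ℕ} {φ : Tm} (M : Tm) (B : Ty) (N : Tm) :
      MemP Γ n φ → MemP (.extE Γ M B N) n φ

/-- `e : M =_A N ∈ Γ`, where `M` and `N` are weakened to the whole of `Γ`. -/
inductive MemE : Ctx → ℕ → Tm → Ty → Tm → Prop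
  | here (Γ : Ctx) (M : Tm) (A : Ty) (N : Tm) : MemE (.extE Γ M A N) 0 M A N
  | extT {Γ : Ctx} {n : ℕ} {M : Tm} {A : Ty} {N : Tm} (B : Ty) :
      MemE Γ n M A N → MemE (.extT Γ B) n (M.ren Nat.succ) A (N.ren Nat.succ)
  | extP {Γ : Ctx} {n : ℕ} {M : Tm} {A : Ty} {N : Tm} (ψ : Tm) :
      MemE Γ n M A N → MemE (.extP Γ ψ) n M A N
  | extE {Γ : Ctx} {n : ℕ} {M : Tm} {A : Ty} {N : Tm} (M' : Tm) (B : Ty) (N' : Tm) :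
      MemE Γ n M A N → MemE (.extE Γ M' B N') (n + 1) M A N

/-- What may stand to the right of the turnstile: `valid`, `M : A`, `δ : φ`, `P : M =_A N`
(the last one written `pa P M A N`). -/
inductive Jdg : Type
  | valid : Jdg
  | tm : Tm → Ty → Jdg
  | pf : Pf → Tm → Jdg
  | pa : Pa → Tm → Ty → Tm → Jdg

/-- `Derivable Γ J` is `Γ ⊢ J`. -/
inductive Derivable : Ctx → Jdg → Prop
  | nil : Derivable .nil .valid
  | ctxT {Γ : Ctx} (A : Ty) : Derivable Γ .valid → Derivable (.extT Γ A) .valid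
  | ctxP {Γ : Ctx} {φ : Tm} : Derivable Γ (.tm φ .omega) → Derivable (.extP Γ φ) .valid
  | ctxE {Γ : Ctx} {M N : Tm} {A : Ty} : Derivable Γ (.tm M A) → Derivable Γ (.tm N A) →
      Derivable (.extE Γ M A N) .valid
  | varT {Γ : Ctx} {n : ℕ} {A : Ty} : Derivable Γ .valid → MemT Γ n A →
      Derivable Γ (.tm (.var n) A)
  | varP {Γ : Ctx} {n : ℕ} {φ : Tm} : Derivable Γ .valid → MemP Γ n φ →
      Derivable Γ (.pf (.pvar n) φ)
  | varE {Γ : Ctx} {n : ℕ} {M N : Tm} {A : Ty} : Derivable Γ .valid → MemE Γ n M A N →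
      Derivable Γ (.pa (.evar n) M A N)
  | bot {Γ : Ctx} : Derivable Γ .valid → Derivable Γ (.tm .bot .omega)
  | imp {Γ : Ctx} {φ ψ : Tm} : Derivable Γ (.tm φ .omega) → Derivable Γ (.tm ψ .omega) →
      Derivable Γ (.tm (.imp φ ψ) .omega)
  | appT {Γ : Ctx} {M N : Tm} {A B : Ty} : Derivable Γ (.tm M (.arrow A B)) →
      Derivable Γ (.tm N A) → Derivable Γ (.tm (.app M N) B)
  | lamT {Γ : Ctx} {M : Tm} {A B : Ty} : Derivable (.extT Γ A) (.tm M B) →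
      Derivable Γ (.tm (.lam A M) (.arrow A B))
  | appP {Γ : Ctx} {δ ε : Pf} {φ ψ : Tm} : Derivable Γ (.pf δ (.imp φ ψ)) →
      Derivable Γ (.pf ε φ) → Derivable Γ (.pf (.papp δ ε) ψ)
  | lamP {Γ : Ctx} {δ : Pf} {φ ψ : Tm} : Derivable (.extP Γ φ) (.pf δ ψ) →
      Derivable Γ (.pf (.plam φ δ) (.imp φ ψ))
  | convP {Γ : Ctx} {δ : Pf} {φ ψ : Tm} : Derivable Γ (.pf δ φ) →
      Derivable Γ (.tm ψ .omega) → Conv φ ψ → Derivable Γ (.pf δ ψ)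
  | ref {Γ : Ctx} {M : Tm} {A : Ty} : Derivable Γ (.tm M A) → Derivable Γ (.pa (.ref M) M A M)
  | impStar {Γ : Ctx} {P Q : Pa} {φ φ' ψ ψ' : Tm} : Derivable Γ (.pa P φ .omega φ') →
      Derivable Γ (.pa Q ψ .omega ψ') →
      Derivable Γ (.pa (.impStar P Q) (.imp φ ψ) .omega (.imp φ' ψ'))
  | univ {Γ : Ctx} {δ ε : Pf} {φ ψ : Tm} : Derivable Γ (.pf δ (.imp φ ψ)) →
      Derivable Γ (.pf ε (.imp ψ φ)) → Derivable Γ (.pa (.univ φ ψ δ ε) φ .omega ψ)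
  | plus {Γ : Ctx} {P : Pa} {φ ψ : Tm} : Derivable Γ (.pa P φ .omega ψ) →
      Derivable Γ (.pf (.plus P) (.imp φ ψ))
  | minus {Γ : Ctx} {P : Pa} {φ ψ : Tm} : Derivable Γ (.pa P φ .omega ψ) →
      Derivable Γ (.pf (.minus P) (.imp ψ φ))
  | lll {Γ : Ctx} {P : Pa} {M N : Tm} {A B : Ty} :
      Derivable (.extE (.extT (.extT Γ A) A) (.var 1) A (.var 0))
        (.pa P (.app (M.ren (fun n => n + 2)) (.var 1)) B
          (.app (N.ren (fun n => n + 2)) (.var 0))) →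
      Derivable Γ (.tm M (.arrow A B)) → Derivable Γ (.tm N (.arrow A B)) →
      Derivable Γ (.pa (.lll A P) M (.arrow A B) N)
  | appE {Γ : Ctx} {P Q : Pa} {M M' N N' : Tm} {A B : Ty} :
      Derivable Γ (.pa P M (.arrow A B) M') → Derivable Γ (.pa Q N A N') →
      Derivable Γ (.tm N A) → Derivable Γ (.tm N' A) →
      Derivable Γ (.pa (.eapp P N N' Q) (.app M N) B (.app M' N'))
  | convE {Γ : Ctx} {P : Pa} {M M' N N' : Tm} {A : Ty} : Derivable Γ (.pa P M A N) →
      Derivable Γ (.tm M' A) → Derivable Γ (.tm N' A) → Conv M M' → Conv N N' →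
      Derivable Γ (.pa P M' A N')

/-! ### Neutral and canonical expressions -/

/-- Neutral paths. -/
inductive NePa : Pa → Prop
  | evar (n : ℕ) : NePa (.evar n)
  | impL {P : Pa} (Q : Pa) : NePa P → NePa (.impStar P Q)
  | impR (Q : Pa) {P : Pa} : NePa P → NePa (.impStar Q P)
  | app {P : Pa} (M N : Tm) (Q : Pa) : NePa P → NePa (.eapp P M N Q)

/-- Neutral proofs. -/
inductive NePf : Pf → Prop
  | pvar (n : ℕ) : NePf (.pvar n)
  | plus {P : Pa} : NePa P → NePf (.plus P)
  | minus {P : Pa} : NePa P → NePf (.minus P)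
  | app {δ : Pf} (ε : Pf) : NePf δ → NePf (.papp δ ε)

/-- Canonical propositions `θ ::= ⊥ | θ ⊃ θ`. -/
inductive Canon : Type
  | bot : Canon
  | imp : Canon → Canon → Canon

/-- A canonical proposition, as a term. -/
def Canon.toTm : Canon → Tm
  | .bot => .bot
  | .imp θ θ' => .imp θ.toTm θ'.toTm

/-! ### Computable expressions -/

/-- `⊨ δ : θ` for a canonical proposition `θ`. -/
def CompCanon : Canon → Pf → Prop
  | .bot, δ => ∃ ν : Pf, Relation.ReflTransGen RedPf δ ν ∧ NePf ν
  | .imp θ θ', δ => ∀ ε : Pf, CompCanon θ ε → CompCanon θ' (.papp δ ε)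

/-- `⊨ δ : φ`: the term `φ` reduces to a canonical proposition `θ` with `⊨ δ : θ`. -/
def CompPf (δ : Pf) (φ : Tm) : Prop :=
  ∃ θ : Canon, Relation.ReflTransGen RedTm φ θ.toTm ∧ CompCanon θ δ

/-- `CompPa A P M N` is `⊨ P : M =_A N`. The hypotheses on `N` and `N'` in the second clause are
`⊨ N : A` and `⊨ N' : A` unfolded. -/
def CompPa : Ty → Pa → Tm → Tm → Prop
  | .omega, P, φ, ψ => CompPf (.plus P) (.imp φ ψ) ∧ CompPf (.minus P) (.imp ψ φ)
  | .arrow A B, P, M, M' => ∀ (Q : Pa) (N N' : Tm),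
      CompPa A N.psubNil N N → CompPa A N'.psubNil N' N' → CompPa A Q N N' →
      CompPa B (.eapp P N N' Q) (.app M N) (.app M' N')

/-- `⊨ M : A`, that is, `⊨ M {} : M =_A M`. -/
def CompTm (M : Tm) (A : Ty) : Prop := CompPa A M.psubNil M M

/-- `⊨ J`; there is nothing to compute in the judgement `valid`. -/
def Computable : Jdg → Prop
  | .valid => True
  | .tm M A => CompTm M A
  | .pf δ φ => CompPf δ φ
  | .pa P M A N => CompPa A P M N

/-- `J [σ]`. -/
def Jdg.sub (σ : Subst) : Jdg → Jdg
  | .valid => .valid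
  | .tm M A => .tm (M.sub σ.tm) A
  | .pf δ φ => .pf (δ.sub σ) (φ.sub σ.tm)
  | .pa P M A N => .pa (P.sub σ) (M.sub σ.tm) A (N.sub σ.tm)

/-- `⊨ σ : Γ`, `σ` is a computable substitution on `Γ`. -/
def CompSubst (σ : Subst) (Γ : Ctx) : Prop :=
  (∀ (n : ℕ) (A : Ty), MemT Γ n A → CompTm (σ.tm n) A) ∧
  (∀ (n : ℕ) (φ : Tm), MemP Γ n φ → CompPf (σ.pf n) (φ.sub σ.tm)) ∧
  (∀ (n : ℕ) (M : Tm) (A : Ty) (N : Tm), MemE Γ n M A N →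
    CompPa A (σ.pa n) (M.sub σ.tm) (N.sub σ.tm))

/-- `⊨ τ : ρ = σ : Γ`, `τ` is a computable path substitution between `ρ` and `σ`. -/
def CompPathSubst (τ : ℕ → Pa) (ρ σ : ℕ → Tm) (Γ : Ctx) : Prop :=
  ∀ (n : ℕ) (A : Ty), MemT Γ n A → CompPa A (τ n) (ρ n) (σ n)

end PHOML

namespace PHOML

open Relation

/-! ### Substitution calculus -/

/-! Both parts go by induction on the derivation, but two rules resist. An application needs its
arguments to be computable terms, whereas `CompPathSubst` only provides computable paths between
them, so the endpoints of a computable path must be shown computable (`CompPa.left`,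
`CompPa.right`). The rule for `ref` needs `ref M` computable when only `M {}` is known to be
(`CompTm.ref`).

Both follow from a test of computability by evaluating one proposition. At each type `A` there is a
tester, a term that returns an implication built from the probes of all its arguments, and `probe A
M` applies `M` to the testers of its argument types. Then `M` is computable at `A` exactly when
`probe A M` reduces to a canonical proposition. In one direction, a computable path can be applied
to testers, which are computable; at type `Ω` both its endpoints then have canonical values
(`CompPa.evals_probe`).

The converse is the heart of the proof (`psubComp`), stated for open terms with testers in place of
the variables and proved by induction on the height of the evaluation. The evaluation imitates weak
head reduction of `M` until a variable `x` comes to the head, as in `x N₁ … Nₖ`. The tester for `x`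
then turns this into an implication containing the probes of all `Nᵢ`, evaluated at smaller heights.
By induction the `Nᵢ` yield computable paths with computable endpoints, to which the computable path
`τ x` can be applied.

Separately, `⊃*` preserves computability (`CompPa.impStar`): a computable path between propositions
reduces to a neutral path, a `ref` or a `univ`, and in the last two cases the action of `P ⊃* Q` can
be computed. This uses closure of computable proofs under reduction, which comes from confluence. -/

@[simp] theorem scons_zero {α : Type} (a : α) (f : ℕ → α) : scons a f 0 = a := rfl

@[simp] theorem scons_succ {α : Type} (a : α) (f : ℕ → α) (n : ℕ) : scons a f (n + 1) = f n := rfl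

theorem upr_comp (f g : ℕ → ℕ) : (fun n => upr g (upr f n)) = upr (fun n => g (f n)) := by
  funext n; cases n <;> rfl

theorem upr_id : upr id = id := by
  funext n; cases n <;> rfl

theorem Tm.ren_ren (M : Tm) : ∀ f g : ℕ → ℕ, (M.ren f).ren g = M.ren (fun n => g (f n)) := by
  induction M <;> intro f g <;> simp_all [Tm.ren, upr_comp]

theorem Tm.ren_id (M : Tm) : M.ren id = M := by
  induction M <;> simp_all [Tm.ren, upr_id]

theorem ups_upr (s : ℕ → Tm) (f : ℕ → ℕ) :
    (fun n => ups s (upr f n)) = ups (fun n => s (f n)) := by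
  funext n; cases n <;> rfl

theorem Tm.sub_ren (M : Tm) : ∀ (f : ℕ → ℕ) (s : ℕ → Tm),
    (M.ren f).sub s = M.sub (fun n => s (f n)) := by
  induction M <;> intro f s <;> simp_all [Tm.ren, Tm.sub, ups_upr]

theorem ren_ups (s : ℕ → Tm) (f : ℕ → ℕ) :
    (fun n => (ups s n).ren (upr f)) = ups (fun n => (s n).ren f) := by
  funext n; cases n <;> simp [ups, Tm.ren, Tm.ren_ren, upr]

theorem Tm.ren_sub (M : Tm) : ∀ (s : ℕ → Tm) (f : ℕ → ℕ),
    (M.sub s).ren f = M.sub (fun n => (s n).ren f) := by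
  induction M <;> intro s f <;> simp_all [Tm.ren, Tm.sub, ren_ups]

theorem sub_ups (s t : ℕ → Tm) :
    (fun n => (ups s n).sub (ups t)) = ups (fun n => (s n).sub t) := by
  funext n; cases n <;> simp [ups, Tm.sub, Tm.sub_ren, Tm.ren_sub]

theorem Tm.sub_sub (M : Tm) : ∀ s t : ℕ → Tm,
    (M.sub s).sub t = M.sub (fun n => (s n).sub t) := by
  induction M <;> intro s t <;> simp_all [Tm.sub, sub_ups]

theorem ups_var : ups Tm.var = Tm.var := by
  funext n; cases n <;> rfl

@[simp] theorem Tm.sub_var (M : Tm) : M.sub Tm.var = M := by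
  induction M <;> simp_all [Tm.sub, ups_var]

theorem Tm.inst_sub (M N : Tm) (s : ℕ → Tm) : (M.inst N).sub s = M.sub (scons (N.sub s) s) := by
  rw [Tm.inst, Tm.sub_sub]
  congr 1; funext n; cases n <;> rfl

theorem Tm.sub_ups_inst (M N : Tm) (s : ℕ → Tm) :
    (M.sub (ups s)).inst N = M.sub (scons N s) := by
  rw [Tm.inst, Tm.sub_sub]
  congr 1; funext n
  cases n with
  | zero => rfl
  | succ n => simp [ups, Tm.sub_ren]

/-! ### Substitution in proofs and paths. -/

theorem Exp.ren_ren {k : Kind} (E : Exp k) : ∀ f g h f' g' h' : ℕ → ℕ,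
    (E.ren f g h).ren f' g' h' =
      E.ren (fun n => f' (f n)) (fun n => g' (g n)) (fun n => h' (h n)) := by
  induction E <;> intros <;> simp_all [Exp.ren, Tm.ren_ren, upr_comp]

/-- Precomposition of a substitution with renamings. -/
def Subst.pre (σ : Subst) (f g h : ℕ → ℕ) : Subst :=
  ⟨fun n => σ.tm (f n), fun n => σ.pf (g n), fun n => σ.pa (h n)⟩

theorem Subst.upP_pre (σ : Subst) (f g h : ℕ → ℕ) :
    σ.upP.pre f (upr g) h = (σ.pre f g h).upP := by
  simp only [Subst.pre, Subst.upP, Subst.mk.injEq, true_and, and_true]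
  funext n; cases n <;> rfl

theorem Subst.upE_pre (σ : Subst) (f g h : ℕ → ℕ) :
    σ.upE.pre (upr (upr f)) g (upr h) = (σ.pre f g h).upE := by
  simp only [Subst.pre, Subst.upE, Subst.mk.injEq, ups_upr, true_and]
  funext n; cases n <;> rfl

theorem Exp.sub_ren {k : Kind} (E : Exp k) : ∀ (f g h : ℕ → ℕ) (σ : Subst),
    (E.ren f g h).sub σ = E.sub (σ.pre f g h) := by
  induction E <;> intros <;>
    simp_all [Exp.ren, Exp.sub, Tm.sub_ren, Subst.upP_pre, Subst.upE_pre]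
  all_goals simp [Subst.pre]

/-- Postcomposition of a substitution with renamings. -/
def Subst.post (σ : Subst) (f g h : ℕ → ℕ) : Subst :=
  ⟨fun n => (σ.tm n).ren f, fun n => (σ.pf n).ren f g h, fun n => (σ.pa n).ren f g h⟩

theorem Subst.upP_post (σ : Subst) (f g h : ℕ → ℕ) :
    σ.upP.post f (upr g) h = (σ.post f g h).upP := by
  simp only [Subst.post, Subst.upP, Subst.mk.injEq, true_and]
  constructor
  · funext n; cases n <;> simp [Exp.ren, Exp.ren_ren, upr]
  · funext n; simp [Exp.ren_ren, upr]

theorem Subst.upE_post (σ : Subst) (f g h : ℕ → ℕ) :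
    σ.upE.post (upr (upr f)) g (upr h) = (σ.post f g h).upE := by
  simp only [Subst.post, Subst.upE, Subst.mk.injEq, ren_ups, true_and]
  constructor
  · funext n; simp [Exp.ren_ren, upr]
  · funext n; cases n <;> simp [Exp.ren, Exp.ren_ren, upr]

theorem Exp.ren_sub {k : Kind} (E : Exp k) : ∀ (σ : Subst) (f g h : ℕ → ℕ),
    (E.sub σ).ren f g h = E.sub (σ.post f g h) := by
  induction E <;> intros <;>
    simp_all [Exp.ren, Exp.sub, Tm.ren_sub, Subst.upP_post, Subst.upE_post]
  all_goals simp [Subst.post]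

/-- Composition of substitutions, `σ` first. -/
def Subst.comp (σ σ' : Subst) : Subst :=
  ⟨fun n => (σ.tm n).sub σ'.tm, fun n => (σ.pf n).sub σ', fun n => (σ.pa n).sub σ'⟩

theorem Subst.upP_comp (σ σ' : Subst) : σ.upP.comp σ'.upP = (σ.comp σ').upP := by
  simp only [Subst.comp, Subst.upP, Subst.mk.injEq, true_and]
  constructor
  · funext n; cases n <;> simp [Exp.sub, Exp.sub_ren, Exp.ren_sub, Subst.pre, Subst.post, Tm.ren_id]
  · funext n; simp [Exp.sub_ren, Exp.ren_sub, Subst.pre, Subst.post, Tm.ren_id]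

theorem ups_add_two (s : ℕ → Tm) (n : ℕ) : ups (ups s) (n + 2) = (s n).ren (fun m => m + 2) := by
  simp [ups, Tm.ren_ren]

theorem Subst.upE_comp (σ σ' : Subst) : σ.upE.comp σ'.upE = (σ.comp σ').upE := by
  simp only [Subst.comp, Subst.upE, Subst.mk.injEq, sub_ups, true_and]
  constructor
  · funext n; simp [Exp.sub_ren, Exp.ren_sub, Subst.pre, Subst.post, ups_add_two]
  · funext n
    cases n <;> simp [Exp.sub, Exp.sub_ren, Exp.ren_sub, Subst.pre, Subst.post, ups_add_two]

theorem Exp.sub_sub {k : Kind} (E : Exp k) : ∀ σ σ' : Subst,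
    (E.sub σ).sub σ' = E.sub (σ.comp σ') := by
  induction E <;> intros <;>
    simp_all [Exp.sub, Tm.sub_sub, Subst.upP_comp, Subst.upE_comp]
  all_goals simp [Subst.comp]

/-- The identity substitution. -/
def Subst.ident : Subst := ⟨Tm.var, Exp.pvar, Exp.evar⟩

theorem Subst.upP_ident : Subst.ident.upP = Subst.ident := by
  simp only [Subst.ident, Subst.upP, Subst.mk.injEq, true_and]
  constructor
  · funext n; cases n <;> rfl
  · rfl

theorem Subst.upE_ident : Subst.ident.upE = Subst.ident := by
  simp only [Subst.ident, Subst.upE, Subst.mk.injEq, ups_var, true_and]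
  constructor
  · rfl
  · funext n; cases n <;> rfl

theorem Exp.sub_ident {k : Kind} (E : Exp k) : E.sub Subst.ident = E := by
  induction E <;> simp_all [Exp.sub, Subst.upP_ident, Subst.upE_ident]
  all_goals simp [Subst.ident]

theorem instP_sub_upP (δ ε : Pf) (σ : Subst) :
    instP (δ.sub σ.upP) ε = δ.sub ⟨σ.tm, scons ε σ.pf, σ.pa⟩ := by
  rw [instP, Exp.sub_sub]
  congr 1
  simp only [Subst.comp, Subst.upP, Subst.mk.injEq, Tm.sub_var, true_and]
  constructor
  · funext n
    cases n with
    | zero => rfl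
    | succ n => exact (Exp.sub_ren _ _ _ _ _).trans (Exp.sub_ident _)
  · funext n; exact (Exp.sub_ren _ _ _ _ _).trans (Exp.sub_ident _)

theorem instE_sub_upE (P : Pa) (M N : Tm) (Q : Pa) (σ : Subst) :
    instE (P.sub σ.upE) M N Q = P.sub ⟨scons N (scons M σ.tm), σ.pf, scons Q σ.pa⟩ := by
  rw [instE, Exp.sub_sub]
  congr 1
  simp only [Subst.comp, Subst.upE, Subst.mk.injEq]
  refine ⟨?_, ?_, ?_⟩
  · funext n
    match n with
    | 0 => rfl
    | 1 => rfl
    | n + 2 => rw [ups_add_two, Tm.sub_ren]; exact Tm.sub_var _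
  · funext n; exact (Exp.sub_ren _ _ _ _ _).trans (Exp.sub_ident _)
  · funext n
    cases n with
    | zero => rfl
    | succ n => exact (Exp.sub_ren _ _ _ _ _).trans (Exp.sub_ident _)

/-! ### Path substitution -/

theorem Tm.psub_ren (M : Tm) : ∀ (f : ℕ → ℕ) (τ : ℕ → Pa) (ρ σ : ℕ → Tm),
    (M.ren f).psub τ ρ σ = M.psub (fun n => τ (f n)) (fun n => ρ (f n)) (fun n => σ (f n)) := by
  induction M with
  | lam A M ih =>
    intro f τ ρ σ
    simp only [Tm.ren, Tm.psub, ih]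
    congr 2 <;> (funext n; cases n <;> rfl)
  | _ => intros; simp_all [Tm.ren, Tm.psub, Tm.sub_ren]

theorem Tm.ren_psub (M : Tm) : ∀ (τ : ℕ → Pa) (ρ σ : ℕ → Tm) (f g h : ℕ → ℕ),
    (M.psub τ ρ σ).ren f g h =
      M.psub (fun n => (τ n).ren f g h) (fun n => (ρ n).ren f) (fun n => (σ n).ren f) := by
  induction M with
  | lam A M ih =>
    intro τ ρ σ f g h
    simp only [Exp.ren, Tm.psub, ih]
    congr 2 <;>
      (funext n; cases n <;> simp [Exp.ren, Tm.ren, Exp.ren_ren, Tm.ren_ren, upr, scons])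
  | _ => intros; simp_all [Exp.ren, Tm.ren, Tm.psub, Tm.ren_sub]

theorem Tm.sub_psub (M : Tm) : ∀ (τ : ℕ → Pa) (ρ σ : ℕ → Tm) (s : Subst),
    (M.psub τ ρ σ).sub s =
      M.psub (fun n => (τ n).sub s) (fun n => (ρ n).sub s.tm) (fun n => (σ n).sub s.tm) := by
  induction M with
  | lam A M ih =>
    intro τ ρ σ s
    simp only [Exp.sub, Tm.psub, ih]
    congr 2
    · funext n
      cases n with
      | zero => rfl
      | succ n =>
        simp [Exp.sub_ren, Exp.ren_sub, Subst.pre, Subst.post, Subst.upE, ups_add_two]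
    · funext n
      cases n with
      | zero => rfl
      | succ n => simp [Tm.sub_ren, Tm.ren_sub, Subst.upE, ups_add_two]
    · funext n
      cases n with
      | zero => rfl
      | succ n => simp [Tm.sub_ren, Tm.ren_sub, Subst.upE, ups_add_two]
  | _ => intros; simp_all [Exp.sub, Tm.sub, Tm.psub, Tm.sub_sub]

theorem Tm.psub_sub (M : Tm) : ∀ (s : ℕ → Tm) (τ : ℕ → Pa) (ρ σ : ℕ → Tm),
    (M.sub s).psub τ ρ σ =
      M.psub (fun n => (s n).psub τ ρ σ) (fun n => (s n).sub ρ) (fun n => (s n).sub σ) := by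
  induction M with
  | lam A M ih =>
    intro s τ ρ σ
    simp only [Tm.sub, Tm.psub, ih]
    congr 2 <;>
      (funext n; cases n <;>
        simp [ups, Tm.psub, Tm.sub, Tm.psub_ren, Tm.ren_psub, Tm.sub_ren, Tm.ren_sub])
  | _ => intros; simp_all [Tm.sub, Tm.psub, Tm.sub_sub]

/-- Instantiating a path substitution that has been extended under a `λ`. -/
theorem Tm.instE_psub (L : Tm) (τ : ℕ → Pa) (ρ σ : ℕ → Tm) (N N' : Tm) (Q : Pa) :
    instE (L.psub
      (scons (.evar 0) (fun n => (τ n).ren (fun m => m + 2) id Nat.succ))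
      (scons (.var 1) (fun n => (ρ n).ren (fun m => m + 2)))
      (scons (.var 0) (fun n => (σ n).ren (fun m => m + 2)))) N N' Q =
    L.psub (scons Q τ) (scons N ρ) (scons N' σ) := by
  rw [instE, Tm.sub_psub]
  congr 1 <;> funext n <;> cases n with
    | zero => rfl
    | succ n => first
      | exact (Exp.sub_ren _ _ _ _ _).trans (Exp.sub_ident _)
      | exact (Tm.sub_ren _ _ _).trans (Tm.sub_var _)

theorem Tm.psub_inst (L N : Tm) (τ : ℕ → Pa) (ρ σ : ℕ → Tm) :
    (L.inst N).psub τ ρ σ =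
      L.psub (scons (N.psub τ ρ σ) τ) (scons (N.sub ρ) ρ) (scons (N.sub σ) σ) := by
  rw [Tm.inst, Tm.psub_sub]
  congr 1 <;> (funext n; cases n <;> rfl)

theorem Tm.psubNil_sub (M : Tm) (s : ℕ → Tm) :
    (M.sub s).psubNil = M.psub (fun n => (s n).psubNil) s s := by
  simp [Tm.psubNil, Tm.psub_sub]

/-! ### Weak head reduction and evaluation of terms -/

/-- Weak head reduction of terms. -/
inductive Whd : Tm → Tm → Prop
  | beta (A : Ty) (M N : Tm) : Whd (.app (.lam A M) N) (M.inst N)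
  | app {M M' : Tm} (N : Tm) : Whd M M' → Whd (.app M N) (.app M' N)

/-- Applications whose head is a proposition `⊥` or `φ ⊃ ψ`. -/
inductive Stuck : Tm → Prop
  | bot (N : Tm) : Stuck (.app .bot N)
  | imp (φ ψ N : Tm) : Stuck (.app (.imp φ ψ) N)
  | app {M : Tm} (N : Tm) : Stuck M → Stuck (.app M N)

/-- `Eval n M θ`: the term `M` evaluates to `θ`, with a derivation of height at most `n`. -/
inductive Eval : ℕ → Tm → Canon → Prop
  | bot (n : ℕ) : Eval n .bot .bot
  | imp {n : ℕ} {φ ψ : Tm} {θ θ' : Canon} : Eval n φ θ → Eval n ψ θ' →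
      Eval (n + 1) (.imp φ ψ) (.imp θ θ')
  | step {n : ℕ} {M M' : Tm} {θ : Canon} : Whd M M' → Eval n M' θ → Eval (n + 1) M θ

theorem Whd.det {M M' M'' : Tm} (h : Whd M M') (h' : Whd M M'') : M' = M'' := by
  induction h generalizing M'' with
  | beta A M N =>
    cases h' with
    | beta => rfl
    | app _ h => nomatch h
  | app N h ih =>
    cases h' with
    | beta => nomatch h
    | app _ h' => rw [ih h']

theorem Whd.red {M M' : Tm} (h : Whd M M') : RedTm M M' := by
  induction h with
  | beta A M N => exact .beta A M N
  | app N _ ih => exact .app N ih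

theorem Whd.sub {M M' : Tm} (h : Whd M M') (s : ℕ → Tm) : Whd (M.sub s) (M'.sub s) := by
  induction h with
  | beta A M N =>
    rw [Tm.inst_sub, ← Tm.sub_ups_inst]
    exact .beta A _ _
  | app N _ ih => exact .app _ ih

theorem Whd.star_app {M M' : Tm} (h : ReflTransGen Whd M M') (N : Tm) :
    ReflTransGen Whd (.app M N) (.app M' N) :=
  h.lift (fun M => Tm.app M N) fun _ _ h => .app N h

theorem Stuck.sub {M : Tm} (h : Stuck M) (s : ℕ → Tm) : Stuck (M.sub s) := by
  induction h with
  | bot N => exact .bot _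
  | imp φ ψ N => exact .imp _ _ _
  | app N _ ih => exact .app _ ih

theorem Stuck.not_whd {M M' : Tm} (h : Stuck M) : ¬ Whd M M' := by
  induction h generalizing M' with
  | bot N => intro h; cases h with | app _ h => nomatch h
  | imp φ ψ N => intro h; cases h with | app _ h => nomatch h
  | app N hM ih =>
    intro h
    cases h with
    | beta => nomatch hM
    | app _ h => exact ih h

theorem Stuck.not_eval {n : ℕ} {M : Tm} {θ : Canon} (h : Stuck M) : ¬ Eval n M θ := by
  intro e
  cases e with
  | bot => nomatch h
  | imp => nomatch h
  | step w _ => exact h.not_whd w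

theorem not_eval_lam {n : ℕ} {A : Ty} {M : Tm} {θ : Canon} : ¬ Eval n (.lam A M) θ := by
  intro e
  cases e with
  | step w _ => nomatch w

theorem Eval.mono {n m : ℕ} {M : Tm} {θ : Canon} (h : Eval n M θ) (hnm : n ≤ m) :
    Eval m M θ := by
  induction h generalizing m with
  | bot n => exact .bot m
  | imp _ _ ih ih' =>
    obtain ⟨m, rfl⟩ : ∃ k, m = k + 1 := ⟨m - 1, by omega⟩
    exact .imp (ih (by omega)) (ih' (by omega))
  | step w _ ih =>
    obtain ⟨m, rfl⟩ : ∃ k, m = k + 1 := ⟨m - 1, by omega⟩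
    exact .step w (ih (by omega))

theorem Eval.imp_inv {n : ℕ} {φ ψ : Tm} {θ : Canon} (h : Eval n (.imp φ ψ) θ) :
    ∃ m < n, ∃ θ₁ θ₂, θ = .imp θ₁ θ₂ ∧ Eval m φ θ₁ ∧ Eval m ψ θ₂ := by
  cases h with
  | imp h h' => exact ⟨_, Nat.lt_succ_self _, _, _, rfl, h, h'⟩
  | step w _ => nomatch w

theorem Eval.whd {n : ℕ} {M M' : Tm} {θ : Canon} (h : Eval n M θ) (w : Whd M M') :
    ∃ m < n, Eval m M' θ := by
  cases h with
  | bot => nomatch w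
  | imp => nomatch w
  | step w' h => exact ⟨_, Nat.lt_succ_self _, w'.det w ▸ h⟩

theorem Eval.whd_star {n : ℕ} {M M' : Tm} {θ : Canon} (h : Eval n M θ)
    (w : ReflTransGen Whd M M') : Eval n M' θ := by
  induction w with
  | refl => exact h
  | tail _ w ih =>
    obtain ⟨m, hm, h⟩ := ih.whd w
    exact h.mono hm.le

theorem Eval.whd_expand {n : ℕ} {M M' : Tm} {θ : Canon} (w : ReflTransGen Whd M M')
    (h : Eval n M' θ) : ∃ m, Eval m M θ := by
  induction w using ReflTransGen.head_induction_on with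
  | refl => exact ⟨n, h⟩
  | head w _ ih =>
    obtain ⟨m, h⟩ := ih
    exact ⟨m + 1, .step w h⟩

/-- Weak head steps commute with substitution and canonical propositions are closed. An open term
that evaluates therefore still does so, at the same height, once its variables are replaced by
testers or stuck terms. -/
theorem Eval.sub {n : ℕ} {M : Tm} {θ : Canon} (h : Eval n M θ) (s : ℕ → Tm) :
    Eval n (M.sub s) θ := by
  induction h with
  | bot n => exact .bot n
  | imp _ _ ih ih' => exact .imp ih ih'
  | step w _ ih => exact .step (w.sub s) ih

theorem Eval.det {n m : ℕ} {M : Tm} {θ θ' : Canon} (h : Eval n M θ) (h' : Eval m M θ') :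
    θ = θ' := by
  induction h generalizing m θ' with
  | bot n =>
    cases h' with
    | bot => rfl
    | step w _ => nomatch w
  | imp _ _ ih₁ ih₂ =>
    obtain ⟨_, _, _, _, rfl, h₁, h₂⟩ := h'.imp_inv
    rw [ih₁ h₁, ih₂ h₂]
  | step w _ ih =>
    obtain ⟨_, _, h'⟩ := h'.whd w
    exact ih h'

theorem eval_toTm (θ : Canon) : ∃ n, Eval n θ.toTm θ := by
  induction θ with
  | bot => exact ⟨0, .bot 0⟩
  | imp θ θ' ih ih' =>
    obtain ⟨n, h⟩ := ih
    obtain ⟨m, h'⟩ := ih'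
    exact ⟨_, .imp (h.mono (le_max_left n m)) (h'.mono (le_max_right n m))⟩

/-- The only other steps of an application take place inside an implication at its head. They leave
it stuck, so they are invisible to evaluation. -/
theorem RedTm.whd_of_app {M N K : Tm} (h : RedTm (.app M N) K) :
    Whd (.app M N) K ∨ (Stuck (.app M N) ∧ Stuck K) := by
  induction M generalizing N K with
  | app M₁ M₂ ih _ =>
    cases h with
    | app _ h =>
      rcases ih h with w | ⟨h, h'⟩
      · exact .inl (.app N w)
      · exact .inr ⟨.app N h, .app N h'⟩
  | imp φ ψ =>
    refine .inr ⟨.imp φ ψ N, ?_⟩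
    cases h with
    | app _ h => cases h <;> exact .imp _ _ _
  | lam A L =>
    cases h with
    | beta => exact .inl (.beta A L N)
    | app _ h => nomatch h
  | _ => cases h with | app _ h => nomatch h

theorem Eval.expand {n : ℕ} {M M' : Tm} {θ : Canon} (r : RedTm M M') (h : Eval n M' θ) :
    ∃ m, Eval m M θ := by
  induction r generalizing n θ with
  | beta A M N => exact ⟨n + 1, .step (.beta A M N) h⟩
  | app N r _ =>
    rcases (RedTm.app N r).whd_of_app with w | ⟨_, h'⟩
    · exact ⟨n + 1, .step w h⟩
    · exact (h'.not_eval h).elim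
  | impL ψ _ ih =>
    obtain ⟨m, _, _, _, rfl, h₁, h₂⟩ := h.imp_inv
    obtain ⟨k, h₁⟩ := ih h₁
    exact ⟨_, .imp (h₁.mono (le_max_left k m)) (h₂.mono (le_max_right k m))⟩
  | impR φ _ ih =>
    obtain ⟨m, _, _, _, rfl, h₁, h₂⟩ := h.imp_inv
    obtain ⟨k, h₂⟩ := ih h₂
    exact ⟨_, .imp (h₁.mono (le_max_left m k)) (h₂.mono (le_max_right m k))⟩

theorem Eval.reduce {n : ℕ} {M M' : Tm} {θ : Canon} (r : RedTm M M') (h : Eval n M θ) :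
    ∃ m, Eval m M' θ := by
  induction r generalizing n θ with
  | beta A M N =>
    obtain ⟨m, _, h⟩ := h.whd (.beta A M N)
    exact ⟨m, h⟩
  | app N r _ =>
    rcases (RedTm.app N r).whd_of_app with w | ⟨h', _⟩
    · obtain ⟨m, _, h⟩ := h.whd w
      exact ⟨m, h⟩
    · exact (h'.not_eval h).elim
  | impL ψ _ ih =>
    obtain ⟨m, _, _, _, rfl, h₁, h₂⟩ := h.imp_inv
    obtain ⟨k, h₁⟩ := ih h₁
    exact ⟨_, .imp (h₁.mono (le_max_left k m)) (h₂.mono (le_max_right k m))⟩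
  | impR φ _ ih =>
    obtain ⟨m, _, _, _, rfl, h₁, h₂⟩ := h.imp_inv
    obtain ⟨k, h₂⟩ := ih h₂
    exact ⟨_, .imp (h₁.mono (le_max_left m k)) (h₂.mono (le_max_right m k))⟩

/-- `M` evaluates to `θ`. -/
def Evals (M : Tm) (θ : Canon) : Prop := ∃ n, Eval n M θ

theorem Evals.det {M : Tm} {θ θ' : Canon} : Evals M θ → Evals M θ' → θ = θ' :=
  fun ⟨_, h⟩ ⟨_, h'⟩ => h.det h'

theorem Evals.imp {φ ψ : Tm} {θ θ' : Canon} : Evals φ θ → Evals ψ θ' →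
    Evals (.imp φ ψ) (.imp θ θ') :=
  fun ⟨n, h⟩ ⟨m, h'⟩ => ⟨_, .imp (h.mono (le_max_left n m)) (h'.mono (le_max_right n m))⟩

theorem Evals.imp_inv {φ ψ : Tm} {θ : Canon} (h : Evals (.imp φ ψ) θ) :
    ∃ θ₁ θ₂, θ = .imp θ₁ θ₂ ∧ Evals φ θ₁ ∧ Evals ψ θ₂ := by
  obtain ⟨n, h⟩ := h
  obtain ⟨m, _, θ₁, θ₂, e, h₁, h₂⟩ := h.imp_inv
  exact ⟨θ₁, θ₂, e, ⟨m, h₁⟩, ⟨m, h₂⟩⟩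

theorem RedTm.star_imp {φ φ' ψ ψ' : Tm} (h : ReflTransGen RedTm φ φ')
    (h' : ReflTransGen RedTm ψ ψ') : ReflTransGen RedTm (.imp φ ψ) (.imp φ' ψ') :=
  (h.lift (fun φ => Tm.imp φ ψ) fun _ _ h => .impL ψ h).trans
    (h'.lift (fun ψ => Tm.imp φ' ψ) fun _ _ h => .impR φ' h)

/-- This trades reduction to a canonical form for a deterministic evaluation with a height to induct
on. -/
theorem evals_iff_star {M : Tm} {θ : Canon} : Evals M θ ↔ ReflTransGen RedTm M θ.toTm := by
  constructor
  · rintro ⟨n, h⟩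
    induction h with
    | bot n => exact .refl
    | imp _ _ ih ih' => exact RedTm.star_imp ih ih'
    | step w _ ih => exact .head w.red ih
  · intro h
    induction h using ReflTransGen.head_induction_on with
    | refl => exact eval_toTm θ
    | head r _ ih =>
      obtain ⟨n, h⟩ := ih
      exact h.expand r

/-- Evaluation is preserved by a single step in either direction, so no confluence of term reduction
is needed for the conversion rules. -/
theorem Conv.evals_iff {M M' : Tm} (h : Conv M M') {θ : Canon} : Evals M θ ↔ Evals M' θ := by
  induction h with
  | rel M M' r => exact ⟨fun ⟨_, h⟩ => h.reduce r, fun ⟨_, h⟩ => h.expand r⟩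
  | refl => exact Iff.rfl
  | symm _ _ _ ih => exact ih.symm
  | trans _ _ _ _ _ ih ih' => exact ih.trans ih'

/-! ### Convertibility of terms. -/

theorem Conv.refl (M : Tm) : Conv M M := EqvGen.refl M

theorem Conv.symm {M M' : Tm} (h : Conv M M') : Conv M' M := EqvGen.symm _ _ h

theorem Conv.of_red {M M' : Tm} (h : RedTm M M') : Conv M M' := EqvGen.rel _ _ h

theorem Conv.map {f : Tm → Tm} (hf : ∀ M M', RedTm M M' → RedTm (f M) (f M')) {M M' : Tm}
    (h : Conv M M') : Conv (f M) (f M') := by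
  induction h with
  | rel _ _ r => exact Conv.of_red (hf _ _ r)
  | refl => exact Conv.refl _
  | symm _ _ _ ih => exact Conv.symm ih
  | trans _ _ _ _ _ ih ih' => exact EqvGen.trans _ _ _ ih ih'

theorem Conv.app {M M' : Tm} (h : Conv M M') (N : Tm) : Conv (.app M N) (.app M' N) :=
  h.map (f := fun M => .app M N) fun _ _ r => .app N r

theorem RedTm.sub {M M' : Tm} (h : RedTm M M') (s : ℕ → Tm) : RedTm (M.sub s) (M'.sub s) := by
  induction h with
  | beta A M N =>
    rw [Tm.inst_sub, ← Tm.sub_ups_inst]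
    exact .beta A _ _
  | app N _ ih => exact .app _ ih
  | impL ψ _ ih => exact .impL _ ih
  | impR φ _ ih => exact .impR _ ih

theorem Conv.sub {M M' : Tm} (h : Conv M M') (s : ℕ → Tm) : Conv (M.sub s) (M'.sub s) :=
  h.map (f := fun M => M.sub s) fun _ _ r => r.sub s

theorem Conv.of_star {M M' : Tm} (h : ReflTransGen Whd M M') : Conv M M' := by
  induction h with
  | refl => exact .refl _
  | tail _ w ih => exact EqvGen.trans _ _ _ ih (Conv.of_red w.red)

/-- If an application reduces weakly to a `λ`, so does its head. -/
theorem whd_lam_of_app {f N : Tm} {A : Ty} {L : Tm}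
    (h : ReflTransGen Whd (.app f N) (.lam A L)) : ∃ B L', ReflTransGen Whd f (.lam B L') := by
  generalize hM : Tm.app f N = M at h
  induction h using ReflTransGen.head_induction_on generalizing f with
  | refl => nomatch hM
  | head w _ ih =>
    subst hM
    cases w with
    | beta B L' => exact ⟨B, L', .refl⟩
    | app _ w =>
      obtain ⟨B, L', h⟩ := ih rfl
      exact ⟨B, L', .head w h⟩

theorem Eval.whd_lam_of_app {n : ℕ} {f N : Tm} {θ : Canon} (h : Eval n (.app f N) θ) :
    ∃ B L, ReflTransGen Whd f (.lam B L) := by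
  generalize hM : Tm.app f N = M at h
  induction h generalizing f with
  | bot => nomatch hM
  | imp => nomatch hM
  | step w _ ih =>
    subst hM
    cases w with
    | beta B L' => exact ⟨B, L', .refl⟩
    | app _ w =>
      obtain ⟨B, L', h⟩ := ih rfl
      exact ⟨B, L', .head w h⟩

/-- Path substitution sends a β-redex to a `λλλ`-redex, and contracting the latter gives the path
substitution of the contractum. -/
theorem RedTm.psub {M M' : Tm} (h : RedTm M M') (τ : ℕ → Pa) (ρ σ : ℕ → Tm) :
    RedPa (M.psub τ ρ σ) (M'.psub τ ρ σ) := by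
  induction h with
  | beta A M N =>
    rw [Tm.psub_inst, ← Tm.instE_psub]
    exact .beta A _ _ _ _
  | app N _ ih => exact .app _ _ _ ih
  | impL ψ _ ih => exact .impL _ ih
  | impR φ _ ih => exact .impR _ ih

/-! ### Confluence of reduction on paths and proofs -/

/-- The constructors consumed by a root redex are irreducible, so root redexes overlap with nothing.
Genuine divergence arises only between the two sides of a `⊃*`, or of a `⊃` under `ref`, and one
step on each side closes it. -/
theorem RedPa.diamond {P P₁ P₂ : Pa} (h₁ : RedPa P P₁) (h₂ : RedPa P P₂) :
    P₁ = P₂ ∨ ∃ P₃, RedPa P₁ P₃ ∧ RedPa P₂ P₃ := by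
  induction h₁ generalizing P₂ with
  | beta A P M N Q =>
    cases h₂ with
    | beta => exact .inl rfl
    | app _ _ _ h => nomatch h
  | refLam A M N N' P =>
    cases h₂ with
    | refLam => exact .inl rfl
    | app _ _ _ h => nomatch h
    | refApp _ _ _ h => nomatch h
  | refRef φ ψ =>
    cases h₂ with
    | refRef => exact .inl rfl
    | impL _ h => nomatch h
    | impR _ h => nomatch h
  | refUniv φ ψ χ δ ε =>
    cases h₂ with
    | refUniv => exact .inl rfl
    | impL _ h => nomatch h
    | impR _ h => nomatch h
  | univRef φ ψ χ δ ε =>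
    cases h₂ with
    | univRef => exact .inl rfl
    | impL _ h => nomatch h
    | impR _ h => nomatch h
  | univUniv φ ψ φ' ψ' δ ε δ' ε' =>
    cases h₂ with
    | univUniv => exact .inl rfl
    | impL _ h => nomatch h
    | impR _ h => nomatch h
  | app M N Q h ih =>
    cases h₂ with
    | beta => nomatch h
    | refLam => nomatch h
    | app _ _ _ h' =>
      rcases ih h' with rfl | ⟨P₃, r, r'⟩
      · exact .inl rfl
      · exact .inr ⟨_, .app M N Q r, .app M N Q r'⟩
    | refApp _ _ _ h' => nomatch h
  | refApp N N' P h =>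
    cases h₂ with
    | refLam => nomatch h
    | app _ _ _ h' => nomatch h'
    | refApp _ _ _ h' =>
      have : ∀ {M M₁ M₂ : Tm}, RedTm M M₁ → RedTm M M₂ →
          M₁ = M₂ ∨ ∃ M₃, RedTm M₁ M₃ ∧ RedTm M₂ M₃ := by
        intro M M₁ M₂ h₁ h₂
        induction h₁ generalizing M₂ with
        | beta A M N =>
          cases h₂ with
          | beta => exact .inl rfl
          | app _ h => nomatch h
        | app N h ih =>
          cases h₂ with
          | beta => nomatch h
          | app _ h' =>
            rcases ih h' with rfl | ⟨_, r, r'⟩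
            · exact .inl rfl
            · exact .inr ⟨_, .app N r, .app N r'⟩
        | impL ψ h ih =>
          cases h₂ with
          | impL _ h' =>
            rcases ih h' with rfl | ⟨_, r, r'⟩
            · exact .inl rfl
            · exact .inr ⟨_, .impL ψ r, .impL ψ r'⟩
          | impR _ h' => exact .inr ⟨_, .impR _ h', .impL _ h⟩
        | impR φ h ih =>
          cases h₂ with
          | impL _ h' => exact .inr ⟨_, .impL _ h', .impR _ h⟩
          | impR _ h' =>
            rcases ih h' with rfl | ⟨_, r, r'⟩
            · exact .inl rfl
            · exact .inr ⟨_, .impR φ r, .impR φ r'⟩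
      rcases this h h' with rfl | ⟨_, r, r'⟩
      · exact .inl rfl
      · exact .inr ⟨_, .refApp N N' P r, .refApp N N' P r'⟩
  | impL Q h ih =>
    cases h₂ with
    | impL _ h' =>
      rcases ih h' with rfl | ⟨_, r, r'⟩
      · exact .inl rfl
      · exact .inr ⟨_, .impL Q r, .impL Q r'⟩
    | impR _ h' => exact .inr ⟨_, .impR _ h', .impL _ h⟩
    | _ => nomatch h
  | impR P h ih =>
    cases h₂ with
    | impL _ h' => exact .inr ⟨_, .impL _ h', .impR _ h⟩
    | impR _ h' =>
      rcases ih h' with rfl | ⟨_, r, r'⟩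
      · exact .inl rfl
      · exact .inr ⟨_, .impR P r, .impR P r'⟩
    | _ => nomatch h

theorem RedPf.diamond {δ δ₁ δ₂ : Pf} (h₁ : RedPf δ δ₁) (h₂ : RedPf δ δ₂) :
    δ₁ = δ₂ ∨ ∃ δ₃, RedPf δ₁ δ₃ ∧ RedPf δ₂ δ₃ := by
  induction h₁ generalizing δ₂ with
  | beta φ δ ε =>
    cases h₂ with
    | beta => exact .inl rfl
    | app _ h => nomatch h
  | refPlus φ =>
    cases h₂ with
    | refPlus => exact .inl rfl
    | plus h => nomatch h
  | refMinus φ =>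
    cases h₂ with
    | refMinus => exact .inl rfl
    | minus h => nomatch h
  | app ε h ih =>
    cases h₂ with
    | beta => nomatch h
    | app _ h' =>
      rcases ih h' with rfl | ⟨_, r, r'⟩
      · exact .inl rfl
      · exact .inr ⟨_, .app ε r, .app ε r'⟩
  | univPlus φ ψ δ ε =>
    cases h₂ with
    | univPlus => exact .inl rfl
    | plus h => nomatch h
  | univMinus φ ψ δ ε =>
    cases h₂ with
    | univMinus => exact .inl rfl
    | minus h => nomatch h
  | plus h =>
    cases h₂ with
    | plus h' =>
      rcases h.diamond h' with rfl | ⟨_, r, r'⟩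
      · exact .inl rfl
      · exact .inr ⟨_, .plus r, .plus r'⟩
    | _ => nomatch h
  | minus h =>
    cases h₂ with
    | minus h' =>
      rcases h.diamond h' with rfl | ⟨_, r, r'⟩
      · exact .inl rfl
      · exact .inr ⟨_, .minus r, .minus r'⟩
    | _ => nomatch h

theorem RedPf.confluent {δ δ₁ δ₂ : Pf} (h₁ : ReflTransGen RedPf δ δ₁)
    (h₂ : ReflTransGen RedPf δ δ₂) :
    ∃ δ₃, ReflTransGen RedPf δ₁ δ₃ ∧ ReflTransGen RedPf δ₂ δ₃ := by
  refine church_rosser (fun a b c hab hac => ?_) h₁ h₂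
  rcases hab.diamond hac with rfl | ⟨d, h, h'⟩
  · exact ⟨b, .refl, .refl⟩
  · exact ⟨d, .single h, .single h'⟩

theorem NePa.red {P P' : Pa} (h : NePa P) (r : RedPa P P') : NePa P' := by
  induction h generalizing P' with
  | evar n => nomatch r
  | impL Q h ih =>
    cases r with
    | impL _ r => exact .impL _ (ih r)
    | impR _ r => exact .impL _ h
    | _ => nomatch h
  | impR Q h ih =>
    cases r with
    | impL _ r => exact .impR _ h
    | impR _ r => exact .impR _ (ih r)
    | _ => nomatch h
  | app M N Q h ih =>
    cases r with
    | app _ _ _ r => exact .app M N Q (ih r)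
    | _ => nomatch h

theorem NePf.red {δ δ' : Pf} (h : NePf δ) (r : RedPf δ δ') : NePf δ' := by
  induction h generalizing δ' with
  | pvar n => nomatch r
  | plus h =>
    cases r with
    | plus r => exact .plus (h.red r)
    | _ => nomatch h
  | minus h =>
    cases r with
    | minus r => exact .minus (h.red r)
    | _ => nomatch h
  | app ε h ih =>
    cases r with
    | app _ r => exact .app ε (ih r)
    | beta => nomatch h

theorem NePf.star {δ δ' : Pf} (h : NePf δ) (r : ReflTransGen RedPf δ δ') : NePf δ' := by
  induction r with
  | refl => exact h
  | tail _ r ih => exact ih.red r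

/-! ### Computable proofs -/

theorem RedPf.star_app {δ δ' : Pf} (h : ReflTransGen RedPf δ δ') (ε : Pf) :
    ReflTransGen RedPf (.papp δ ε) (.papp δ' ε) :=
  h.lift (fun δ => Exp.papp δ ε) fun _ _ h => .app ε h

theorem RedPa.star_plus {P P' : Pa} (h : ReflTransGen RedPa P P') :
    ReflTransGen RedPf (.plus P) (.plus P') :=
  h.lift Exp.plus fun _ _ h => .plus h

theorem RedPa.star_minus {P P' : Pa} (h : ReflTransGen RedPa P P') :
    ReflTransGen RedPf (.minus P) (.minus P') :=
  h.lift Exp.minus fun _ _ h => .minus h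

theorem RedPa.star_impStar {P P' Q Q' : Pa} (h : ReflTransGen RedPa P P')
    (h' : ReflTransGen RedPa Q Q') :
    ReflTransGen RedPa (.impStar P Q) (.impStar P' Q') :=
  (h.lift (fun P => Exp.impStar P Q) fun _ _ h => .impL Q h).trans
    (h'.lift (fun Q => Exp.impStar P' Q) fun _ _ h => .impR P' h)

theorem CompCanon.expand {θ : Canon} {δ δ' : Pf} (r : ReflTransGen RedPf δ δ')
    (h : CompCanon θ δ') : CompCanon θ δ := by
  induction θ generalizing δ δ' with
  | bot =>
    obtain ⟨ν, hν, n⟩ := h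
    exact ⟨ν, r.trans hν, n⟩
  | imp θ θ' _ ih => exact fun ε hε => ih (RedPf.star_app r ε) (h ε hε)

/-- At `⊥`, confluence joins the reduct to a neutral proof, and reducts of neutral proofs are
neutral. -/
theorem CompCanon.reduce {θ : Canon} {δ δ' : Pf} (r : ReflTransGen RedPf δ δ')
    (h : CompCanon θ δ) : CompCanon θ δ' := by
  induction θ generalizing δ δ' with
  | bot =>
    obtain ⟨ν, hν, n⟩ := h
    obtain ⟨ν', h, h'⟩ := RedPf.confluent r hν
    exact ⟨ν', h, n.star h'⟩
  | imp θ θ' _ ih => exact fun ε hε => ih (RedPf.star_app r ε) (h ε hε)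

theorem CompCanon.neutral {θ : Canon} {δ : Pf} (h : NePf δ) : CompCanon θ δ := by
  induction θ generalizing δ with
  | bot => exact ⟨δ, .refl, h⟩
  | imp θ θ' _ ih => exact fun ε _ => ih (.app ε h)

/-- `PathSpine P δ`: the proof `δ` is `P⁺` or `P⁻` applied to a sequence of arguments. -/
inductive PathSpine (P : Pa) : Pf → Prop
  | plus : PathSpine P (.plus P)
  | minus : PathSpine P (.minus P)
  | app {δ : Pf} (ε : Pf) : PathSpine P δ → PathSpine P (.papp δ ε)

/-- `Acts P a b`: the path `P` reduces to a path `ref φ` or `univ φ ψ δ ε`, where `a` and `b`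
describe how `P⁺` and `P⁻` act on proofs. -/
inductive Acts (P : Pa) : (Pf → Pf) → (Pf → Pf) → Prop
  | ref {φ : Tm} : ReflTransGen RedPa P (.ref φ) → Acts P id id
  | univ {φ ψ : Tm} {δ ε : Pf} : ReflTransGen RedPa P (.univ φ ψ δ ε) →
      Acts P (.papp δ) (.papp ε)

theorem PathSpine.red {P : Pa} {δ δ' : Pf} (h : PathSpine P δ) (r : RedPf δ δ') :
    (∃ a b, Acts P a b) ∨ ∃ P', RedPa P P' ∧ PathSpine P' δ' := by
  induction h generalizing δ' with
  | plus =>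
    cases r with
    | refPlus => exact .inl ⟨_, _, .ref .refl⟩
    | univPlus => exact .inl ⟨_, _, .univ .refl⟩
    | plus r => exact .inr ⟨_, r, .plus⟩
  | minus =>
    cases r with
    | refMinus => exact .inl ⟨_, _, .ref .refl⟩
    | univMinus => exact .inl ⟨_, _, .univ .refl⟩
    | minus r => exact .inr ⟨_, r, .minus⟩
  | app ε h ih =>
    cases r with
    | beta => nomatch h
    | app _ r =>
      rcases ih r with h | ⟨P', r, h⟩
      · exact .inl h
      · exact .inr ⟨P', r, .app ε h⟩

theorem PathSpine.neutral {P : Pa} {δ : Pf} (h : PathSpine P δ) (n : NePf δ) : NePa P := by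
  induction h with
  | plus => cases n; assumption
  | minus => cases n; assumption
  | app ε _ ih => cases n with | app _ n => exact ih n

/-- Each step on a spine either reduces the path inside or eliminates the sign, and the latter
requires a `ref` or a `univ`. If no sign is ever eliminated, the final spine is neutral, hence so is
its path. -/
theorem PathSpine.cases {P : Pa} {δ ν : Pf} (h : PathSpine P δ) (r : ReflTransGen RedPf δ ν)
    (n : NePf ν) : (∃ P', ReflTransGen RedPa P P' ∧ NePa P') ∨ ∃ a b, Acts P a b := by
  induction r using ReflTransGen.head_induction_on generalizing P with
  | refl => exact .inl ⟨P, .refl, h.neutral n⟩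
  | head r _ ih =>
    rcases h.red r with h | ⟨P', r, h⟩
    · exact .inr h
    · rcases ih h with ⟨P'', r', h⟩ | ⟨a, b, h⟩
      · exact .inl ⟨P'', .head r r', h⟩
      · cases h with
        | ref r' => exact .inr ⟨_, _, .ref (.head r r')⟩
        | univ r' => exact .inr ⟨_, _, .univ (.head r r')⟩

theorem CompCanon.path_cases {θ : Canon} {P : Pa} {δ : Pf} (h : CompCanon θ δ)
    (s : PathSpine P δ) : (∃ P', ReflTransGen RedPa P P' ∧ NePa P') ∨ ∃ a b, Acts P a b := by
  induction θ generalizing δ with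
  | bot =>
    obtain ⟨ν, r, n⟩ := h
    exact s.cases r n
  -- A proof variable is computable at every canonical proposition, so it can serve as an argument
  -- that brings the spine down to `⊥`.
  | imp θ θ' _ ih => exact ih (h (.pvar 0) (.neutral (.pvar 0))) (.app _ s)

theorem instP_var (φ : Tm) (α : Pf) : RedPf (.papp (.plam φ (.pvar 0)) α) α := .beta φ _ α

theorem Acts.plus {P : Pa} {a b : Pf → Pf} (h : Acts P a b) (α : Pf) :
    ReflTransGen RedPf (.papp (.plus P) α) (a α) := by
  cases h with
  | ref r =>
    exact ((RedPf.star_app (RedPa.star_plus r) α).tail (.app α (.refPlus _))).tail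
      (instP_var _ α)
  | univ r => exact (RedPf.star_app (RedPa.star_plus r) α).tail (.app α (.univPlus _ _ _ _))

theorem Acts.minus {P : Pa} {a b : Pf → Pf} (h : Acts P a b) (α : Pf) :
    ReflTransGen RedPf (.papp (.minus P) α) (b α) := by
  cases h with
  | ref r =>
    exact ((RedPf.star_app (RedPa.star_minus r) α).tail (.app α (.refMinus _))).tail
      (instP_var _ α)
  | univ r => exact (RedPf.star_app (RedPa.star_minus r) α).tail (.app α (.univMinus _ _ _ _))

theorem beta_two {φ ψ : Tm} {γ α β : Pf} :
    ReflTransGen RedPf (.papp (.papp (.plam φ (.plam ψ γ)) α) β)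
      (γ.sub ⟨Tm.var, scons β (scons α Exp.pvar), Exp.evar⟩) := by
  refine .head (.app β (.beta _ _ α)) ?_
  refine .head (.beta _ _ β) ?_
  rw [instP_sub_upP]

theorem wkPP_sub (δ α β : Pf) :
    (wkPP δ).sub ⟨Tm.var, scons β (scons α Exp.pvar), Exp.evar⟩ = δ := by
  rw [wkPP, Exp.sub_ren]
  exact Exp.sub_ident δ

/-- Since `ref` acts as the identity, one formula covers all four rules for `⊃*`. -/
theorem Acts.impStar_plus {P Q : Pa} {a b c d : Pf → Pf} (hP : Acts P a b) (hQ : Acts Q c d)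
    (α β : Pf) : ReflTransGen RedPf (.papp (.papp (.plus (.impStar P Q)) α) β)
      (c (.papp α (b β))) := by
  cases hP with
  | ref r =>
    cases hQ with
    | ref r' =>
      have h := RedPf.star_app (RedPf.star_app (((RedPa.star_plus
        ((RedPa.star_impStar r r').tail (.refRef _ _)))).tail (.refPlus _)) α) β
      exact h.tail (.app β (instP_var _ α))
    | univ r' =>
      have h := RedPf.star_app (RedPf.star_app (((RedPa.star_plus
        ((RedPa.star_impStar r r').tail (.refUniv _ _ _ _ _)))).tail (.univPlus _ _ _ _)) α) β
      have h' := h.trans beta_two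
      simpa [Exp.sub, wkPP_sub] using h'
  | univ r =>
    cases hQ with
    | ref r' =>
      have h := RedPf.star_app (RedPf.star_app (((RedPa.star_plus
        ((RedPa.star_impStar r r').tail (.univRef _ _ _ _ _)))).tail (.univPlus _ _ _ _)) α) β
      have h' := h.trans beta_two
      simpa [Exp.sub, wkPP_sub] using h'
    | univ r' =>
      have h := RedPf.star_app (RedPf.star_app (((RedPa.star_plus
        ((RedPa.star_impStar r r').tail (.univUniv _ _ _ _ _ _ _ _)))).tail
          (.univPlus _ _ _ _)) α) β
      have h' := h.trans beta_two
      simpa [Exp.sub, wkPP_sub] using h'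

theorem Acts.impStar_minus {P Q : Pa} {a b c d : Pf → Pf} (hP : Acts P a b) (hQ : Acts Q c d)
    (α β : Pf) : ReflTransGen RedPf (.papp (.papp (.minus (.impStar P Q)) α) β)
      (d (.papp α (a β))) := by
  cases hP with
  | ref r =>
    cases hQ with
    | ref r' =>
      have h := RedPf.star_app (RedPf.star_app (((RedPa.star_minus
        ((RedPa.star_impStar r r').tail (.refRef _ _)))).tail (.refMinus _)) α) β
      exact h.tail (.app β (instP_var _ α))
    | univ r' =>
      have h := RedPf.star_app (RedPf.star_app (((RedPa.star_minus
        ((RedPa.star_impStar r r').tail (.refUniv _ _ _ _ _)))).tail (.univMinus _ _ _ _)) α) β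
      have h' := h.trans beta_two
      simpa [Exp.sub, wkPP_sub] using h'
  | univ r =>
    cases hQ with
    | ref r' =>
      have h := RedPf.star_app (RedPf.star_app (((RedPa.star_minus
        ((RedPa.star_impStar r r').tail (.univRef _ _ _ _ _)))).tail (.univMinus _ _ _ _)) α) β
      have h' := h.trans beta_two
      simpa [Exp.sub, wkPP_sub] using h'
    | univ r' =>
      have h := RedPf.star_app (RedPf.star_app (((RedPa.star_minus
        ((RedPa.star_impStar r r').tail (.univUniv _ _ _ _ _ _ _ _)))).tail
          (.univMinus _ _ _ _)) α) β
      have h' := h.trans beta_two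
      simpa [Exp.sub, wkPP_sub] using h'

/-! ### Computability of proofs at arbitrary propositions. -/

theorem compPf_iff {δ : Pf} {φ : Tm} : CompPf δ φ ↔ ∃ θ, Evals φ θ ∧ CompCanon θ δ := by
  simp only [CompPf, evals_iff_star]

theorem CompPf.conv {δ : Pf} {φ ψ : Tm} (h : CompPf δ φ) (c : Conv φ ψ) : CompPf δ ψ := by
  rw [compPf_iff] at h ⊢
  obtain ⟨θ, e, h⟩ := h
  exact ⟨θ, c.evals_iff.1 e, h⟩

theorem CompPf.expand {δ δ' : Pf} {φ : Tm} (r : ReflTransGen RedPf δ δ') (h : CompPf δ' φ) :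
    CompPf δ φ := by
  obtain ⟨θ, e, h⟩ := h
  exact ⟨θ, e, h.expand r⟩

theorem CompPf.app {δ ε : Pf} {φ ψ : Tm} (h : CompPf δ (.imp φ ψ)) (h' : CompPf ε φ) :
    CompPf (.papp δ ε) ψ := by
  rw [compPf_iff] at *
  obtain ⟨θ, e, h⟩ := h
  obtain ⟨θ₁, θ₂, rfl, e₁, e₂⟩ := e.imp_inv
  obtain ⟨θ', e', h'⟩ := h'
  obtain rfl := e₁.det e'
  exact ⟨θ₂, e₂, h ε h'⟩

/-- That `φ` and `ψ` evaluate has to be assumed: computability at `φ ⊃ ψ` requires it, and the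
condition on arguments is vacuous if `φ` has no value. -/
theorem CompPf.of_app {δ : Pf} {φ ψ : Tm} {θ θ' : Canon} (e : Evals φ θ) (e' : Evals ψ θ')
    (h : ∀ ε, CompPf ε φ → CompPf (.papp δ ε) ψ) : CompPf δ (.imp φ ψ) := by
  refine compPf_iff.2 ⟨_, e.imp e', fun ε hε => ?_⟩
  obtain ⟨θ'', e'', h⟩ := compPf_iff.1 (h ε (compPf_iff.2 ⟨θ, e, hε⟩))
  exact e'.det e'' ▸ h

/-! ### Computable paths -/

theorem CompPa.expand {A : Ty} {P P' : Pa} {M N : Tm} (r : ReflTransGen RedPa P P')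
    (h : CompPa A P' M N) : CompPa A P M N := by
  induction A generalizing P P' M N with
  | omega => exact ⟨h.1.expand (RedPa.star_plus r), h.2.expand (RedPa.star_minus r)⟩
  | arrow A B _ ih =>
    intro Q N N' hN hN' hQ
    exact ih (r.lift (fun P => Exp.eapp P N N' Q) fun _ _ r => .app N N' Q r)
      (h Q N N' hN hN' hQ)

theorem Conv.imp {φ φ' ψ ψ' : Tm} (h : Conv φ φ') (h' : Conv ψ ψ') :
    Conv (.imp φ ψ) (.imp φ' ψ') :=
  EqvGen.trans _ _ _ (h.map (f := fun φ => .imp φ ψ) fun _ _ r => .impL ψ r)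
    (h'.map (f := fun ψ => .imp φ' ψ) fun _ _ r => .impR φ' r)

theorem CompPa.conv {A : Ty} {P : Pa} {M M' N N' : Tm} (h : CompPa A P M N) (c : Conv M M')
    (c' : Conv N N') : CompPa A P M' N' := by
  induction A generalizing P M M' N N' with
  | omega => exact ⟨h.1.conv (c.imp c'), h.2.conv (c'.imp c)⟩
  | arrow A B _ ih =>
    intro Q K K' hK hK' hQ
    exact ih (h Q K K' hK hK' hQ) (c.app K) (c'.app K')

theorem CompPa.evals {P : Pa} {φ ψ : Tm} (h : CompPa .omega P φ ψ) :
    ∃ θ θ', Evals φ θ ∧ Evals ψ θ' := by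
  obtain ⟨θ, e, _⟩ := compPf_iff.1 h.1
  obtain ⟨θ₁, θ₂, _, e₁, e₂⟩ := e.imp_inv
  exact ⟨θ₁, θ₂, e₁, e₂⟩

theorem CompPa.ref_omega {φ : Tm} {θ : Canon} (e : Evals φ θ) : CompPa .omega (.ref φ) φ φ := by
  have h : Acts (.ref φ) id id := .ref .refl
  exact ⟨.of_app e e fun ε hε => hε.expand (h.plus ε),
    .of_app e e fun ε hε => hε.expand (h.minus ε)⟩

theorem CompPf.reduce {δ δ' : Pf} {φ : Tm} (r : ReflTransGen RedPf δ δ') (h : CompPf δ φ) :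
    CompPf δ' φ := by
  obtain ⟨θ, e, h⟩ := h
  exact ⟨θ, e, h.reduce r⟩

theorem CompPa.neutral {P P' : Pa} {φ ψ : Tm} {θ θ' : Canon} (e : Evals φ θ) (e' : Evals ψ θ')
    (r : ReflTransGen RedPa P P') (n : NePa P') : CompPa .omega P φ ψ :=
  ⟨compPf_iff.2 ⟨_, e.imp e', (CompCanon.neutral (.plus n)).expand (RedPa.star_plus r)⟩,
    compPf_iff.2 ⟨_, e'.imp e, (CompCanon.neutral (.minus n)).expand (RedPa.star_minus r)⟩⟩

theorem CompPa.impStar {P Q : Pa} {φ φ' ψ ψ' : Tm} (hP : CompPa .omega P φ φ')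
    (hQ : CompPa .omega Q ψ ψ') :
    CompPa .omega (.impStar P Q) (.imp φ ψ) (.imp φ' ψ') := by
  obtain ⟨θ₁, θ₁', e₁, e₁'⟩ := hP.evals
  obtain ⟨θ₂, θ₂', e₂, e₂'⟩ := hQ.evals
  have cases_of : ∀ {P : Pa} {φ φ' : Tm}, CompPa .omega P φ φ' →
      (∃ P', ReflTransGen RedPa P P' ∧ NePa P') ∨ ∃ a b, Acts P a b := fun h => by
    obtain ⟨θ, _, h⟩ := h.1
    exact h.path_cases .plus
  rcases cases_of hP with ⟨P', r, n⟩ | ⟨a, b, aP⟩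
  · exact .neutral (e₁.imp e₂) (e₁'.imp e₂') (RedPa.star_impStar r .refl) (.impL Q n)
  rcases cases_of hQ with ⟨Q', r, n⟩ | ⟨c, d, aQ⟩
  · exact .neutral (e₁.imp e₂) (e₁'.imp e₂') (RedPa.star_impStar .refl r) (.impR P n)
  constructor
  · refine .of_app (e₁.imp e₂) (e₁'.imp e₂') fun α hα => .of_app e₁' e₂' fun β hβ => ?_
    refine .expand (aP.impStar_plus aQ α β) ?_
    -- Computability is known for `P⁻ β`, while the formula contains its reduct `b β`; closure under
    -- reduction bridges the two, and likewise for `Q⁺`.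
    exact (hQ.1.app (hα.app ((hP.2.app hβ).reduce (aP.minus β)))).reduce (aQ.plus _)
  · refine .of_app (e₁'.imp e₂') (e₁.imp e₂) fun α hα => .of_app e₁ e₂ fun β hβ => ?_
    refine .expand (aP.impStar_minus aQ α β) ?_
    exact (hQ.2.app (hα.app ((hP.1.app hβ).reduce (aP.plus β)))).reduce (aQ.minus _)

/-! ### Probes and testers -/

/-- Simultaneously for a type `A = A₁ → ⋯ → Aₙ → Ω`: the probe `M ↦ M u₁ ⋯ uₙ`, and the tester
`c ↦ λ x₁ … xₙ. (probe xₙ ⊃ ⋯ ⊃ probe x₁ ⊃ c)`, where `uᵢ` is the tester of type `Aᵢ` at `⊥`. -/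
def probeTester : Ty → (Tm → Tm) × (Tm → Tm)
  | .omega => (id, id)
  | .arrow A B =>
    (fun M => (probeTester B).1 (.app M ((probeTester A).2 .bot)),
      fun c => .lam A ((probeTester B).2
        (.imp ((probeTester A).1 (.var 0)) (c.ren Nat.succ))))

/-- The application of a term to the testers of its argument types. -/
def probe (A : Ty) : Tm → Tm := (probeTester A).1

/-- The term that probes all its arguments. -/
def tester (A : Ty) : Tm → Tm := (probeTester A).2

theorem probe_arrow (A B : Ty) (M : Tm) :
    probe (.arrow A B) M = probe B (.app M (tester A .bot)) := rfl

theorem tester_arrow (A B : Ty) (c : Tm) :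
    tester (.arrow A B) c =
      .lam A (tester B (.imp (probe A (.var 0)) (c.ren Nat.succ))) := rfl

theorem probe_tester_sub (A : Ty) : ∀ s : ℕ → Tm,
    (∀ M, (probe A M).sub s = probe A (M.sub s)) ∧
      ∀ c, (tester A c).sub s = tester A (c.sub s) := by
  induction A with
  | omega => exact fun s => ⟨fun _ => rfl, fun _ => rfl⟩
  | arrow A B ihA ihB =>
    intro s
    constructor
    · intro M
      simp only [probe_arrow, (ihB _).1, Tm.sub, (ihA _).2]
    · intro c
      simp only [tester_arrow, Tm.sub, (ihB _).2, (ihA _).1, Tm.sub_ren, Tm.ren_sub, ups,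
        scons_zero, scons_succ]

theorem probe_sub (A : Ty) (M : Tm) (s : ℕ → Tm) : (probe A M).sub s = probe A (M.sub s) :=
  (probe_tester_sub A s).1 M

theorem tester_sub (A : Ty) (c : Tm) (s : ℕ → Tm) : (tester A c).sub s = tester A (c.sub s) :=
  (probe_tester_sub A s).2 c

theorem tester_app (A B : Ty) (c N : Tm) :
    Whd (.app (tester (.arrow A B) c) N) (tester B (.imp (probe A N) c)) := by
  have h := Whd.beta A (tester B (.imp (probe A (.var 0)) (c.ren Nat.succ))) N
  rwa [Tm.inst, tester_sub, Tm.sub, probe_sub, Tm.sub_ren,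
    show (c.sub fun n => scons N Tm.var (Nat.succ n)) = c from Tm.sub_var c] at h

theorem Whd.star_probe (A : Ty) {M M' : Tm} (h : ReflTransGen Whd M M') :
    ReflTransGen Whd (probe A M) (probe A M') := by
  induction A generalizing M M' with
  | omega => exact h
  | arrow A B _ ih => exact ih (Whd.star_app h _)

/-- Feeding a tester its first argument adds a probe to the accumulated proposition, so the
induction on the type must allow any `c` that evaluates. -/
theorem evals_probe_tester (A : Ty) {c : Tm} {θ : Canon} (h : Evals c θ) :
    ∃ θ', Evals (probe A (tester A c)) θ' := by
  induction A generalizing c θ with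
  | omega => exact ⟨θ, h⟩
  | arrow A B ihA ihB =>
    obtain ⟨θ₁, h₁⟩ := ihA ⟨0, .bot 0⟩
    obtain ⟨θ₂, n, h₂⟩ := ihB (h₁.imp h)
    exact ⟨θ₂, h₂.whd_expand (Whd.star_probe B (.single (tester_app A B c _)))⟩

/-- The substitution of testers for the variables that `Δ` types, and of a stuck term for the
others. -/
def testSub (Δ : ℕ → Option Ty) (n : ℕ) : Tm :=
  (Δ n).elim (.app .bot .bot) fun A => tester A .bot

theorem testSub_scons (A : Ty) (Δ : ℕ → Option Ty) :
    testSub (scons (some A) Δ) = scons (tester A .bot) (testSub Δ) := by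
  funext n; cases n <;> rfl

/-- `τ` is a computable path substitution between the computable substitutions `ρ` and `σ`, at the
variables that `Δ` types. -/
def CompRel (Δ : ℕ → Option Ty) (τ : ℕ → Pa) (ρ σ : ℕ → Tm) : Prop :=
  ∀ n A, Δ n = some A → CompTm (ρ n) A ∧ CompTm (σ n) A ∧ CompPa A (τ n) (ρ n) (σ n)

theorem CompRel.left {Δ : ℕ → Option Ty} {τ : ℕ → Pa} {ρ σ : ℕ → Tm} (h : CompRel Δ τ ρ σ) :
    CompRel Δ (fun n => (ρ n).psubNil) ρ ρ :=
  fun n A hn => ⟨(h n A hn).1, (h n A hn).1, (h n A hn).1⟩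

theorem CompRel.right {Δ : ℕ → Option Ty} {τ : ℕ → Pa} {ρ σ : ℕ → Tm} (h : CompRel Δ τ ρ σ) :
    CompRel Δ (fun n => (σ n).psubNil) σ σ :=
  fun n A hn => ⟨(h n A hn).2.1, (h n A hn).2.1, (h n A hn).2.1⟩

theorem CompRel.scons {Δ : ℕ → Option Ty} {τ : ℕ → Pa} {ρ σ : ℕ → Tm} (h : CompRel Δ τ ρ σ)
    {A : Ty} {Q : Pa} {N N' : Tm} (hN : CompTm N A) (hN' : CompTm N' A) (hQ : CompPa A Q N N') :
    CompRel (scons (some A) Δ) (scons Q τ) (scons N ρ) (scons N' σ) := by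
  intro n B hn
  cases n with
  | zero => cases hn; exact ⟨hN, hN', hQ⟩
  | succ n => exact h n B hn

/-- Path substitution into `M` preserves computability, at every `Δ` for which the probe of `M`
evaluates with height at most `n`. -/
def PsubComp (n : ℕ) (A : Ty) : Prop :=
  ∀ (Δ : ℕ → Option Ty) (M : Tm) (θ : Canon) (τ : ℕ → Pa) (ρ σ : ℕ → Tm),
    Eval n (probe A (M.sub (testSub Δ))) θ → CompRel Δ τ ρ σ →
      CompPa A (M.psub τ ρ σ) (M.sub ρ) (M.sub σ)

/-- Terms whose head is a variable. -/
inductive VarHead : Tm → Prop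
  | var (n : ℕ) : VarHead (.var n)
  | app {M : Tm} (N : Tm) : VarHead M → VarHead (.app M N)

theorem app_head_cases (M N : Tm) :
    VarHead (.app M N) ∨ (∃ K, Whd (.app M N) K) ∨ Stuck (.app M N) := by
  induction M generalizing N with
  | var n => exact .inl (.app N (.var n))
  | bot => exact .inr (.inr (.bot N))
  | imp φ ψ => exact .inr (.inr (.imp φ ψ N))
  | lam A L => exact .inr (.inl ⟨_, .beta A L N⟩)
  | app M₁ M₂ ih =>
    rcases ih M₂ with h | ⟨K, h⟩ | h
    · exact .inl (.app N h)
    · exact .inr (.inl ⟨_, .app N h⟩)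
    · exact .inr (.inr (.app N h))

/-- The tester at the head accumulates in `c` the probes of the arguments met so far. An evaluation
of `c` thus contains strictly smaller evaluations of those probes, and the induction hypothesis
makes each argument computable. -/
theorem VarHead.testSub_cases {n : ℕ} (ih : ∀ m < n, ∀ A, PsubComp m A) (Δ : ℕ → Option Ty)
    {M : Tm} (h : VarHead M) :
    (∃ K, ReflTransGen Whd (M.sub (testSub Δ)) K ∧ Stuck K) ∨
    ∃ B c, ReflTransGen Whd (M.sub (testSub Δ)) (tester B c) ∧
      (c = .bot ∨ ∃ φ ψ, c = .imp φ ψ) ∧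
      ∀ m < n, ∀ θ, Eval m c θ → ∀ τ ρ σ, CompRel Δ τ ρ σ →
        CompPa B (M.psub τ ρ σ) (M.sub ρ) (M.sub σ) := by
  induction h with
  | var x =>
    cases hx : Δ x with
    | none => exact .inl ⟨_, .refl, by simpa [Tm.sub, testSub, hx] using Stuck.bot _⟩
    | some A =>
      refine .inr ⟨A, .bot, ?_, .inl rfl, fun _ _ _ _ τ ρ σ h => (h x A hx).2.2⟩
      simpa [Tm.sub, testSub, hx] using ReflTransGen.refl
  | @app M N _ ihM =>
    rcases ihM with ⟨K, r, s⟩ | ⟨B, c, r, hc, hcomp⟩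
    · exact .inl ⟨_, Whd.star_app r _, .app _ s⟩
    · cases B with
      | omega =>
        -- One argument too many: `c` is already a proposition, so applying it is stuck.
        refine .inl ⟨_, Whd.star_app r _, ?_⟩
        rcases hc with rfl | ⟨φ, ψ, rfl⟩
        · exact .bot _
        · exact .imp _ _ _
      | arrow A B =>
        refine .inr ⟨B, _, (Whd.star_app r _).tail (tester_app A B c _), .inr ⟨_, _, rfl⟩, ?_⟩
        intro m hm θ e τ ρ σ h
        obtain ⟨k, hk, θ₁, θ₂, _, e₁, e₂⟩ := e.imp_inv
        have hN := ih k (hk.trans hm) A Δ N θ₁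
        -- The endpoints are covered by the same hypothesis on `N`, used with `ρ` and then `σ` on
        -- both sides. This is why `CompRel` includes computability of `ρ` and `σ`.
        refine hcomp k (hk.trans hm) θ₂ e₂ τ ρ σ h _ _ _ ?_ ?_ (hN τ ρ σ e₁ h)
        · rw [Tm.psubNil_sub]; exact hN _ ρ ρ e₁ h.left
        · rw [Tm.psubNil_sub]; exact hN _ σ σ e₁ h.right

theorem psubComp_omega {n : ℕ} (ih : ∀ m < n, ∀ A, PsubComp m A) : PsubComp n .omega := by
  intro Δ M θ τ ρ σ e h
  change Eval n (M.sub (testSub Δ)) θ at e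
  cases M with
  | var x =>
    cases hx : Δ x with
    | none =>
      simp only [Tm.sub, testSub, hx, Option.elim] at e
      exact ((Stuck.bot _).not_eval e).elim
    | some A =>
      cases A with
      | omega => exact (h x _ hx).2.2
      | arrow A B =>
        simp only [Tm.sub, testSub, hx, Option.elim, tester_arrow] at e
        exact (not_eval_lam e).elim
  | bot => exact .ref_omega ⟨0, .bot 0⟩
  | imp φ ψ =>
    obtain ⟨m, hm, θ₁, θ₂, _, e₁, e₂⟩ := e.imp_inv
    exact (ih m hm .omega Δ φ θ₁ τ ρ σ e₁ h).impStar (ih m hm .omega Δ ψ θ₂ τ ρ σ e₂ h)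
  | lam A L => exact (not_eval_lam e).elim
  | app M N =>
    rcases app_head_cases M N with v | ⟨K, w⟩ | s
    · rcases v.testSub_cases ih Δ with ⟨K, r, s⟩ | ⟨B, c, r, hc, hcomp⟩
      · exact (s.not_eval (e.whd_star r)).elim
      · cases B with
        | omega =>
          -- An application is neither `⊥` nor an implication, so at least one weak head step
          -- occurs; it supplies the strict drop in height.
          rcases r.cases_head with r | ⟨K, w, r⟩
          · rcases hc with rfl | ⟨φ, ψ, rfl⟩ <;> nomatch r
          · obtain ⟨m, hm, e⟩ := e.whd w
            exact hcomp m hm θ (e.whd_star r) τ ρ σ h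
        | arrow A B => exact (not_eval_lam (e.whd_star r)).elim
    · obtain ⟨m, hm, e⟩ := e.whd (w.sub _)
      exact ((ih m hm .omega Δ K θ τ ρ σ e h).expand (.single (w.red.psub τ ρ σ))).conv
        (Conv.of_red (w.sub ρ).red).symm (Conv.of_red (w.sub σ).red).symm
    · exact ((s.sub _).not_eval e).elim

theorem psubComp (n : ℕ) (A : Ty) : PsubComp n A := by
  induction n using Nat.strong_induction_on generalizing A with
  | _ n ih =>
    induction A with
    | omega => exact psubComp_omega ih
    | arrow A B _ ihB =>
      intro Δ M θ τ ρ σ e h Q N N' hN hN' hQ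
      -- Apply `M` to a fresh variable of type `A`. With testers substituted, the probe of `M x` at
      -- `B` is the very probe of `M` at `A → B`, so the height is unchanged while the type
      -- decreases.
      have key := ihB (scons (some A) Δ) (.app (M.ren Nat.succ) (.var 0)) θ
        (scons Q τ) (scons N ρ) (scons N' σ)
        (by simpa [Tm.sub, Tm.sub_ren, testSub_scons, probe_arrow] using e)
        (h.scons hN hN' hQ)
      simpa [Tm.sub, Tm.psub, Tm.sub_ren, Tm.psub_ren] using key

/-! ### Endpoints of computable paths -/

/-- When no variable is typed, `CompRel` holds vacuously, so the identity path substitution is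
allowed even for open `M`. -/
theorem compTm_of_evals {M : Tm} {A : Ty} {θ : Canon} (h : Evals (probe A M) θ) :
    CompTm M A := by
  obtain ⟨n, h⟩ := h
  have key := psubComp n A (fun _ => none) M θ (fun n => .ref (.var n)) Tm.var Tm.var
    (probe_sub A M _ ▸ h.sub _) (fun _ _ h => nomatch h)
  simpa [CompTm, Tm.psubNil] using key

theorem compTm_tester (A : Ty) : CompTm (tester A .bot) A := by
  obtain ⟨θ, h⟩ := evals_probe_tester A (c := .bot) ⟨0, .bot 0⟩
  exact compTm_of_evals h

theorem CompPa.evals_probe {A : Ty} {P : Pa} {M N : Tm} (h : CompPa A P M N) :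
    ∃ θ θ', Evals (probe A M) θ ∧ Evals (probe A N) θ' := by
  induction A generalizing P M N with
  | omega => exact h.evals
  | arrow A B _ ih =>
    have hu := compTm_tester A
    exact ih (h _ _ _ hu hu hu)

theorem CompPa.left {A : Ty} {P : Pa} {M N : Tm} (h : CompPa A P M N) : CompTm M A := by
  obtain ⟨_, _, h, _⟩ := h.evals_probe
  exact compTm_of_evals h

theorem CompPa.right {A : Ty} {P : Pa} {M N : Tm} (h : CompPa A P M N) : CompTm N A := by
  obtain ⟨_, _, _, h⟩ := h.evals_probe
  exact compTm_of_evals h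

theorem Evals.whd_lam_of_probe {A : Ty} {M N : Tm} {θ : Canon}
    (h : Evals (probe A (.app M N)) θ) : ∃ B L, ReflTransGen Whd M (.lam B L) := by
  induction A generalizing M N with
  | omega =>
    obtain ⟨n, h⟩ := h
    exact h.whd_lam_of_app
  | arrow A B _ ih =>
    obtain ⟨_, _, h⟩ := ih h
    exact PHOML.whd_lam_of_app h

theorem RedPa.star_refApp {M M' : Tm} (h : ReflTransGen Whd M M') (N N' : Tm) (P : Pa) :
    ReflTransGen RedPa (.eapp (.ref M) N N' P) (.eapp (.ref M') N N' P) :=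
  h.lift (fun M => Exp.eapp (.ref M) N N' P) fun _ _ w => .refApp N N' P w.red

/-- A path `ref M` can only fire once `M` is a `λ`. The probe of `M` evaluates, which forces `M` to
reach some `λ x. L` and also evaluates the probe of `L` with a tester for `x`; then `psubComp`
applies to `L`. -/
theorem CompTm.ref {M : Tm} {A : Ty} (h : CompTm M A) : CompPa A (.ref M) M M := by
  obtain ⟨θ, _, e, _⟩ := CompPa.evals_probe h
  cases A with
  | omega => exact .ref_omega e
  | arrow A B =>
    rw [probe_arrow] at e
    obtain ⟨C, L, r⟩ := e.whd_lam_of_probe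
    intro Q N N' hN hN' hQ
    obtain ⟨n, e⟩ := e
    have w := fun K => (Whd.star_app r K).tail (.beta C L K)
    -- The remaining free variables become stuck terms, which gives the form `L.sub (testSub Δ)`
    -- with only `x` typed.
    have e := (e.whd_star (Whd.star_probe B (w (tester A .bot)))).sub (testSub fun _ => none)
    rw [probe_sub, Tm.inst_sub, tester_sub, Tm.sub, ← testSub_scons] at e
    have key := psubComp n B _ L θ (scons Q fun n => .ref (.var n)) (scons N Tm.var)
      (scons N' Tm.var) e
      (CompRel.scons (Δ := fun _ => none) (fun _ _ h => nomatch h) hN hN' hQ)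
    exact (key.expand ((RedPa.star_refApp r N N' Q).tail (.refLam C L N N' Q))).conv
      (Conv.of_star (w N)).symm (Conv.of_star (w N')).symm

/-! ### The fundamental theorem -/

theorem CompPathSubst.extT {τ : ℕ → Pa} {ρ σ : ℕ → Tm} {Γ : Ctx} (h : CompPathSubst τ ρ σ Γ)
    {A : Ty} {Q : Pa} {N N' : Tm} (hQ : CompPa A Q N N') :
    CompPathSubst (scons Q τ) (scons N ρ) (scons N' σ) (.extT Γ A) := by
  intro n B hn
  cases hn with
  | here => exact hQ
  | extT _ hn => exact h _ _ hn

theorem app_lam_sub (A : Ty) (L N : Tm) (s : ℕ → Tm) :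
    RedTm (.app ((Tm.lam A L).sub s) N) (L.sub (scons N s)) := by
  rw [← Tm.sub_ups_inst]
  exact .beta A _ N

theorem Derivable.comp_psub {Γ : Ctx} {M : Tm} {A : Ty} (h : Derivable Γ (.tm M A))
    {τ : ℕ → Pa} {ρ σ : ℕ → Tm} (hτ : CompPathSubst τ ρ σ Γ) :
    CompPa A (M.psub τ ρ σ) (M.sub ρ) (M.sub σ) := by
  generalize hJ : Jdg.tm M A = J at h
  induction h generalizing M A τ ρ σ with
  | varT _ hn => cases hJ; exact hτ _ _ hn
  | bot _ => cases hJ; exact .ref_omega ⟨0, .bot 0⟩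
  | imp _ _ ih₁ ih₂ => cases hJ; exact (ih₁ hτ rfl).impStar (ih₂ hτ rfl)
  | appT _ _ ih₁ ih₂ =>
    cases hJ
    have h := ih₂ hτ rfl
    -- The arguments `N[ρ]` and `N[σ]` are computable as endpoints of the path `N {τ}`.
    exact ih₁ hτ rfl _ _ _ h.left h.right h
  | lamT _ ih =>
    cases hJ
    intro Q N N' _ _ hQ
    refine CompPa.conv (.expand (.single (.beta _ _ N N' Q)) ?_)
      (Conv.of_red (app_lam_sub _ _ N ρ)).symm (Conv.of_red (app_lam_sub _ _ N' σ)).symm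
    rw [Tm.instE_psub]
    exact ih (hτ.extT hQ) rfl
  | _ => nomatch hJ

theorem Derivable.comp_sub {Γ : Ctx} {M : Tm} {A : Ty} (h : Derivable Γ (.tm M A))
    {σ : Subst} (hσ : CompSubst σ Γ) : CompTm (M.sub σ.tm) A := by
  rw [CompTm, Tm.psubNil_sub]
  exact h.comp_psub fun n B hn => hσ.1 n B hn

/-- All assumptions `p : φ` of the context are well formed over the entries that precede them. -/
def Ctx.WfProps : Ctx → Prop
  | .nil => True
  | .extT Γ _ => Γ.WfProps
  | .extP Γ φ => Γ.WfProps ∧ Derivable Γ (.tm φ .omega)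
  | .extE Γ _ _ _ => Γ.WfProps

/-- The rule for `λ p : φ` has no premise `φ : Ω`; it is recovered here from the context of its
premise. -/
theorem Derivable.wfProps {Γ : Ctx} {J : Jdg} (h : Derivable Γ J) : Γ.WfProps := by
  induction h with
  | nil => trivial
  | ctxP h ih => exact ⟨ih, h⟩
  | lamP _ ih => exact ih.1
  | _ => assumption

theorem CompTm.evals {φ : Tm} (h : CompTm φ .omega) : ∃ θ, Evals φ θ := by
  obtain ⟨θ, _, e, _⟩ := CompPa.evals h
  exact ⟨θ, e⟩

theorem CompSubst.extP {σ : Subst} {Γ : Ctx} (h : CompSubst σ Γ) {φ : Tm} {ε : Pf}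
    (hε : CompPf ε (φ.sub σ.tm)) :
    CompSubst ⟨σ.tm, scons ε σ.pf, σ.pa⟩ (.extP Γ φ) := by
  refine ⟨fun n A hn => ?_, fun n ψ hn => ?_, fun n M A N hn => ?_⟩
  · cases hn with | extP _ hn => exact h.1 _ _ hn
  · cases hn with
    | here => exact hε
    | extP _ hn => exact h.2.1 _ _ hn
  · cases hn with | extP _ hn => exact h.2.2 _ _ _ _ hn

theorem CompSubst.extE {σ : Subst} {Γ : Ctx} (h : CompSubst σ Γ) {A : Ty} {N N' : Tm} {Q : Pa}
    (hN : CompTm N A) (hN' : CompTm N' A) (hQ : CompPa A Q N N') :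
    CompSubst ⟨scons N' (scons N σ.tm), σ.pf, scons Q σ.pa⟩
      (.extE (.extT (.extT Γ A) A) (.var 1) A (.var 0)) := by
  have hsub : ∀ M : Tm, ((M.ren Nat.succ).ren Nat.succ).sub (scons N' (scons N σ.tm)) =
      M.sub σ.tm := fun M => by simp [Tm.sub_ren]
  refine ⟨fun n B hn => ?_, fun n ψ hn => ?_, fun n M B K hn => ?_⟩
  · cases hn with
    | extE _ _ _ hn =>
      cases hn with
      | here => exact hN'
      | extT _ hn =>
        cases hn with
        | here => exact hN
        | extT _ hn => exact h.1 _ _ hn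
  · cases hn with
    | extE _ _ _ hn =>
      cases hn with
      | extT _ hn =>
        cases hn with
        | extT _ hn => rw [hsub]; exact h.2.1 _ _ hn
  · cases hn with
    | here => exact hQ
    | extE _ _ _ hn =>
      cases hn with
      | extT _ hn =>
        cases hn with
        | extT _ hn => rw [hsub, hsub]; exact h.2.2 _ _ _ _ hn

theorem Derivable.computable {Γ : Ctx} {J : Jdg} (h : Derivable Γ J) {σ : Subst}
    (hσ : CompSubst σ Γ) : Computable (J.sub σ) := by
  induction h generalizing σ with
  | nil => trivial
  | ctxT => trivial
  | ctxP => trivial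
  | ctxE => trivial
  | varT h hn => exact hσ.1 _ _ hn
  | varP h hn => exact hσ.2.1 _ _ hn
  | varE h hn => exact hσ.2.2 _ _ _ _ hn
  | bot h => exact (Derivable.bot h).comp_sub hσ
  | imp h h' => exact (Derivable.imp h h').comp_sub hσ
  | appT h h' => exact (Derivable.appT h h').comp_sub hσ
  | lamT h => exact (Derivable.lamT h).comp_sub hσ
  | appP _ _ ih₁ ih₂ => exact CompPf.app (ih₁ hσ) (ih₂ hσ)
  | @lamP Γ δ φ ψ h ih =>
    -- Both propositions must be shown to evaluate: `φ` because it is well formed over `Γ`, and `ψ`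
    -- by the induction hypothesis with a computable proof variable in place of `p`.
    obtain ⟨θ, e⟩ := (h.wfProps.2.comp_sub hσ).evals
    have hp : CompPf (.pvar 0) (φ.sub σ.tm) :=
      compPf_iff.2 ⟨θ, e, .neutral (.pvar 0)⟩
    obtain ⟨θ', e', _⟩ := compPf_iff.1 (ih (hσ.extP hp))
    refine CompPf.of_app e e' fun ε hε => ?_
    refine .expand (.single (.beta _ _ ε)) ?_
    rw [instP_sub_upP]
    exact ih (hσ.extP hε)
  | convP _ _ c ih _ => exact (ih hσ).conv (c.sub σ.tm)
  | ref h => exact (h.comp_sub hσ).ref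
  | impStar _ _ ih₁ ih₂ => exact CompPa.impStar (ih₁ hσ) (ih₂ hσ)
  | univ _ _ ih₁ ih₂ =>
    exact ⟨(ih₁ hσ).expand (.single (.univPlus _ _ _ _)),
      (ih₂ hσ).expand (.single (.univMinus _ _ _ _))⟩
  | plus _ ih => exact (ih hσ).1
  | minus _ ih => exact (ih hσ).2
  | lll _ _ _ ih _ _ =>
    intro Q N N' hN hN' hQ
    refine .expand (.single (.beta _ _ N N' Q)) ?_
    rw [instE_sub_upE]
    have key := ih (hσ.extE hN hN' hQ)
    simpa [Computable, Jdg.sub, Tm.sub, Tm.sub_ren] using key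
  | appE _ _ h h' ih₁ ih₂ _ _ =>
    exact ih₁ hσ _ _ _ (h.comp_sub hσ) (h'.comp_sub hσ) (ih₂ hσ)
  | convE _ _ _ c c' ih _ _ => exact CompPa.conv (ih hσ) (c.sub σ.tm) (c'.sub σ.tm)

end PHOML

theorem mainTheorem2 :
    (∀ (Γ : PHOML.Ctx) (J : PHOML.Jdg) (σ : PHOML.Subst),
      PHOML.Derivable Γ J → PHOML.CompSubst σ Γ → PHOML.Computable (J.sub σ)) ∧
    (∀ (Γ : PHOML.Ctx) (M : PHOML.Tm) (A : PHOML.Ty)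
        (τ : ℕ → PHOML.Pa) (ρ σ : ℕ → PHOML.Tm),
      PHOML.Derivable Γ (.tm M A) → PHOML.CompPathSubst τ ρ σ Γ →
        PHOML.CompPa A (M.psub τ ρ σ) (M.sub ρ) (M.sub σ)) :=
  ⟨fun _ _ _ h hσ => h.computable hσ, fun _ _ _ _ _ _ h hτ => h.comp_psub hτ⟩
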